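/- **Setting.** Let $C\subset\mathbb R^N$ be a compact convex set with nonempty interior and $C^2$ boundary, with outward unit normal $\nu$ on $\partial C$, tangent spaces $T_c\partial C=\nu(c)^\perp$, and shape operator $S_c$ defined by $D\nu(c)[v]=-S_cv$. Let $\Omega\in\mathcal O_C$, that is: $\Omega\subset\mathbb R^N$ is open, $\operatorname{int}C\subset\Omega$, $\partial\Omega$ is Lipschitz outside $C$, for every $c\in\partial C$ the ray $\{c+t\nu(c):t\ge 0\}$ meets $\Omega$ in a connected set, and for almost every $x\in\partial\Omega$ at which the inward unit normal $n(x)$ of $\Omega$ exists, the half-line $\{x+tn(x):t\ge0\}$ meets $C$. Let $d(c)=\sup\{r\ge0: c+r\nu(c)\in\Omega\}$ be the thickness function, $\Phi(c)=c+d(c)\nu(c)$, and for $x\in\partial\Omega\setminus C$ let $\pi(x)=x+t(x)n(x)$, where $t(x)$ is the smallest $t\ge 0$ with $x+tn(x)\in C$. Assume that the return map $F=\pi\circ\Phi:\partial C\to\partial C$ is defined at every point of $\partial C$ (in particular $d$ is finite, $\Phi(c)\in\partial\Omega\setminus C$, and $n(\Phi(c))$ exists, for every $c$). Let $\mathrm{Crit}(d)$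 be the set of points of $\partial C$ at which $d$ is differentiable with $\nabla_{\partial C}d=0$. **Theorem 6.1.** The return map determines the critical set of $d$, the stability type of each fixed point, and the basin decomposition of $\partial C$ under $c_{k+1}=F(c_k)$. Precisely: 1. $\mathrm{Fix}(F)=\mathrm{Crit}(d)$. 2. Suppose that $d$ is of class $C^2$, and let $p\in\mathrm{Fix}(F)$. Then $I-d(p)S_p$ is invertible, $A(p)=d(p)\,(I-d(p)S_p)^{-1}$ is symmetric and positive definite on $T_p\partial C$, and $F$ is differentiable at $p$ with $$DF(p)=I+A(p)\,\mathrm{Hess}_{\partial C}d(p).$$ The endomorphism $DF(p)$ of $T_p\partial C$ is diagonalizable over $\mathbb R$. Let the stability type $(n_s,n_0,n_u)$ of $p$ be the numbers of eigenvalues of $DF(p)$, with multiplicity, of modulus $<1$, $=1$, $>1$; it is thus read off from $F$, and equals the corresponding triple of $I+A(p)\,\mathrm{Hess}_{\partial C}d(p)$. If $n_s=N-1$, then $p$ is asymptotically stable for $F$ (Lyapunov stable, and attracting a neighbourhood of itself). If $n_u>0$, then $p$ is not Lyapunov stable. If $n_u=N-1$, then $p$ is repelling: some neighbourhood $U$ of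 $p$ is left by every orbit that starts in $U\setminus\{p\}$. 3. Suppose that $d$ is of class $C^1$, and for $p\in\partial C$ let $B_F(p)=\{c\in\partial C: F^k(c)\to p \text{ as } k\to\infty\}$ be its basin. Then $B_F(p)\neq\emptyset$ if and only if $p\in\mathrm{Crit}(d)$; for $p\in\mathrm{Crit}(d)$ one has $p\in B_F(p)$ and $F^{-1}(B_F(p))=B_F(p)$; the basins of distinct critical points are disjoint; and $\bigcup_{p\in\mathrm{Crit}(d)}B_F(p)$ is the set of all points of $\partial C$ whose orbit under $F$ converges. -/

import Mathlib

open Set Filter Topology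
open scoped NNReal RealInnerProductSpace

namespace ReturnMap

noncomputable section

/-- `ℝ^N` with its Euclidean norm. -/
abbrev Euc (N : ℕ) : Type := EuclideanSpace ℝ (Fin N)

/-- `K` has a boundary of class `C^2`: near each boundary point, `K = {φ ≤ 0}` for a `C^2` function
`φ` with nonvanishing differential. -/
def HasC2Boundary {N : ℕ} (K : Set (Euc N)) : Prop :=
  ∀ c ∈ frontier K, ∃ φ : Euc N → ℝ,
    ContDiffAt ℝ 2 φ c ∧ fderiv ℝ φ c ≠ 0 ∧ ∀ᶠ y in 𝓝 c, (y ∈ K ↔ φ y ≤ 0)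

/-- A convex core: a compact convex set with nonempty interior and `C^2` boundary. -/
structure IsConvexCore {N : ℕ} (C : Set (Euc N)) : Prop where
  isCompact : IsCompact C
  convex : Convex ℝ C
  interior_nonempty : (interior C).Nonempty
  hasC2Boundary : HasC2Boundary C

/-- `u` is an outward unit normal of the convex set `C` at `c`. It exists and is unique
at every boundary point of a convex core. -/
def IsOutwardUnitNormal {N : ℕ} (C : Set (Euc N)) (c u : Euc N) : Prop :=
  ‖u‖ = 1 ∧ ∀ y ∈ C, ⟪u, y - c⟫ ≤ 0

/-- The outward unit normal `ν(c)`. -/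
def outwardNormal {N : ℕ} (C : Set (Euc N)) (c : Euc N) : Euc N :=
  Classical.epsilon (IsOutwardUnitNormal C c)

/-- `n` is the inward unit normal of `Ω` at `x`: to first order at the boundary point `x`, the set
`Ω` is the half-space into which `n` points. There is at most one such `n`; at a boundary point near
which `Ω` is the subgraph of a Lipschitz function, it exists exactly if the function is
differentiable there. -/
def IsInwardUnitNormal {N : ℕ} (Ω : Set (Euc N)) (x n : Euc N) : Prop :=
  x ∈ frontier Ω ∧ ‖n‖ = 1 ∧ ∀ ε > (0 : ℝ), ∀ᶠ y in 𝓝 x,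
    (ε * ‖y - x‖ < ⟪n, y - x⟫ → y ∈ Ω) ∧ (⟪n, y - x⟫ < -(ε * ‖y - x‖) → y ∉ Ω)

/-- The boundary of `Ω` is Lipschitz outside `C`: near each point of `∂Ω \ C`, the set `Ω` is the
strict subgraph, in some unit direction `e`, of a Lipschitz function of the coordinates orthogonal
to `e`. -/
def IsLipschitzOutside {N : ℕ} (C Ω : Set (Euc N)) : Prop :=
  ∀ x ∈ frontier Ω \ C, ∃ (e : Euc N) (K : ℝ≥0) (g : Euc N → ℝ),
    ‖e‖ = 1 ∧ LipschitzWith K g ∧ (∀ (y : Euc N) (s : ℝ), g (y + s • e) = g y) ∧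
      ∀ᶠ y in 𝓝 x, (y ∈ Ω ↔ ⟪e, y⟫ < g y)

/-- The `C`-geometric normal property: for almost every (with respect to `(N-1)`-dimensional
Hausdorff measure) boundary point `x` of `Ω` at which the inward unit normal exists, the inward
normal half-line issued from `x` meets `C`. -/
def GeometricNormalProperty {N : ℕ} (C Ω : Set (Euc N)) : Prop :=
  MeasureTheory.Measure.hausdorffMeasure ((N : ℝ) - 1)
    {x ∈ frontier Ω | ∃ n, IsInwardUnitNormal Ω x n ∧ ∀ t : ℝ, 0 ≤ t → x + t • n ∉ C} = 0

/-- The class `𝒪_C` of admissible domains. -/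
structure ClassO {N : ℕ} (C Ω : Set (Euc N)) : Prop where
  isOpen : IsOpen Ω
  interior_subset : interior C ⊆ Ω
  lipschitz : IsLipschitzOutside C Ω
  ray_connected : ∀ c ∈ frontier C,
    IsPreconnected ({x | ∃ t : ℝ, 0 ≤ t ∧ x = c + t • outwardNormal C c} ∩ Ω)
  normal_property : GeometricNormalProperty C Ω

/-- The thickness function `d : ∂C → ℝ`. -/
def thickness {N : ℕ} (C Ω : Set (Euc N)) (c : frontier C) : ℝ :=
  sSup {r : ℝ | 0 ≤ r ∧ (c : Euc N) + r • outwardNormal C c ∈ Ω}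

/-- The radial map `Φ(c) = c + d(c) ν(c)`. -/
def radialMap {N : ℕ} (C Ω : Set (Euc N)) (c : frontier C) : Euc N :=
  (c : Euc N) + thickness C Ω c • outwardNormal C c

/-- `y = π(x)` for the reciprocal map `π` on `∂Ω \ C`: `y` is the first point of `C` on the inward
normal half-line issued from `x`. -/
def IsReciprocalImage {N : ℕ} (C Ω : Set (Euc N)) (x y : Euc N) : Prop :=
  x ∈ frontier Ω \ C ∧ ∃ (n : Euc N) (t : ℝ), IsInwardUnitNormal Ω x n ∧
    IsLeast {s : ℝ | 0 ≤ s ∧ x + s • n ∈ C} t ∧ y = x + t • n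

/-- `F = π ∘ Φ : ∂C → ∂C` is the (everywhere defined) return map of `Ω`. -/
def IsReturnMap {N : ℕ} (C Ω : Set (Euc N)) (F : frontier C → frontier C) : Prop :=
  ∀ c : frontier C, IsReciprocalImage C Ω (radialMap C Ω c) (F c)

/-! Calculus on the hypersurface `∂C ⊆ ℝ^N`. -/

/-- The tangent space `T_c ∂C`, the orthogonal complement of `ν(c)`. -/
abbrev tangentSpace {N : ℕ} (C : Set (Euc N)) (c : frontier C) : Submodule ℝ (Euc N) :=
  (Submodule.span ℝ {outwardNormal C (c : Euc N)})ᗮ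

/-- The orthogonal projection of `ℝ^N` onto `T_c ∂C`. -/
def tangentProj {N : ℕ} (C : Set (Euc N)) (c : frontier C) : Euc N →L[ℝ] tangentSpace C c :=
  (tangentSpace C c).orthogonalProjectionOnto

/-- `L : T_c ∂C → V` is the differential at `c` of the map `f : ∂C → V`. -/
def HasSurfaceDerivAt {N : ℕ} {C : Set (Euc N)} {V : Type*} [NormedAddCommGroup V]
    [NormedSpace ℝ V] (f : frontier C → V) (c : frontier C) (L : tangentSpace C c →L[ℝ] V) : Prop :=
  (fun y : frontier C => f y - f c - L (tangentProj C c ((y : Euc N) - c)))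
    =o[𝓝 c] fun y : frontier C => (y : Euc N) - c

open Classical in
/-- The differential at `c` of `f : ∂C → V` (zero if `f` is not differentiable at `c`). -/
def surfaceDeriv {N : ℕ} {C : Set (Euc N)} {V : Type*} [NormedAddCommGroup V]
    [NormedSpace ℝ V] (f : frontier C → V) (c : frontier C) : tangentSpace C c →L[ℝ] V :=
  if h : ∃ L, HasSurfaceDerivAt f c L then h.choose else 0

/-- `f : ∂C → ℝ` is of class `C^k`: locally it is the restriction of a `C^k` function on `ℝ^N`. -/
def SurfaceContDiff {N : ℕ} {C : Set (Euc N)} (k : ℕ) (f : frontier C → ℝ) : Prop :=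
  ∀ c : frontier C, ∃ g : Euc N → ℝ, ContDiffAt ℝ k g (c : Euc N) ∧
    ∀ᶠ y : frontier C in 𝓝 c, f y = g y

/-- The Riemannian gradient `∇_{∂C} f (c) ∈ T_c ∂C`. -/
def surfaceGrad {N : ℕ} {C : Set (Euc N)} (f : frontier C → ℝ) (c : frontier C) :
    tangentSpace C c :=
  (InnerProductSpace.toDual ℝ (tangentSpace C c)).symm (surfaceDeriv f c)

/-- The Riemannian Hessian at `c`, as an operator on `T_c ∂C`: the covariant derivative (tangential
part of the ambient derivative) of the gradient field. -/
def surfaceHess {N : ℕ} {C : Set (Euc N)} (f : frontier C → ℝ) (c : frontier C) :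
    tangentSpace C c →L[ℝ] tangentSpace C c :=
  tangentProj C c ∘L surfaceDeriv (fun y : frontier C => (surfaceGrad f y : Euc N)) c

/-- The shape operator `S_c` with the sign convention `Dν(c)[v] = - S_c v`. -/
def shapeOperator {N : ℕ} (C : Set (Euc N)) (c : frontier C) :
    tangentSpace C c →L[ℝ] tangentSpace C c :=
  -(tangentProj C c ∘L surfaceDeriv (fun y : frontier C => outwardNormal C (y : Euc N)) c)

/-- `Crit(f)`: the points at which `f` is differentiable with `∇_{∂C} f = 0`. -/
def Crit {N : ℕ} {C : Set (Euc N)} (f : frontier C → ℝ) : Set (frontier C) :=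
  {c | (∃ L, HasSurfaceDerivAt f c L) ∧ surfaceGrad f c = 0}

/-- `I - d(c) S_c`, the tangential part of the differential of the radial map. -/
def radialOperator {N : ℕ} (C Ω : Set (Euc N)) (c : frontier C) :
    tangentSpace C c →L[ℝ] tangentSpace C c :=
  1 - thickness C Ω c • shapeOperator C c

/-- The geometric operator `A(c) = d(c) (I - d(c) S_c)⁻¹`. -/
def roundTripOperator {N : ℕ} (C Ω : Set (Euc N)) (c : frontier C) :
    tangentSpace C c →L[ℝ] tangentSpace C c :=
  thickness C Ω c • Ring.inverse (radialOperator C Ω c)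

/-- The linearized round trip `I + A(c) Hess_{∂C} d (c)`. -/
def roundTripLinearization {N : ℕ} (C Ω : Set (Euc N)) (c : frontier C) :
    tangentSpace C c →L[ℝ] tangentSpace C c :=
  1 + roundTripOperator C Ω c ∘L surfaceHess (thickness C Ω) c

/-! Discrete dynamics. -/

/-- The basin of `p`: the points whose orbit converges to `p`. -/
def basin {X : Type*} [TopologicalSpace X] (F : X → X) (p : X) : Set X :=
  {c | Tendsto (fun k : ℕ => F^[k] c) atTop (𝓝 p)}

def IsLyapunovStable {X : Type*} [TopologicalSpace X] (F : X → X) (p : X) : Prop :=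
  ∀ U ∈ 𝓝 p, ∃ V ∈ 𝓝 p, ∀ c ∈ V, ∀ k : ℕ, F^[k] c ∈ U

def IsAsymptoticallyStable {X : Type*} [TopologicalSpace X] (F : X → X) (p : X) : Prop :=
  IsLyapunovStable F p ∧ basin F p ∈ 𝓝 p

/-- `p` is repelling: some neighbourhood of `p` is left by every orbit starting in it, except
at `p`. -/
def IsRepelling {X : Type*} [TopologicalSpace X] (F : X → X) (p : X) : Prop :=
  ∃ U ∈ 𝓝 p, ∀ c ∈ U, c ≠ p → ∃ k : ℕ, F^[k] c ∉ U

/-- The numbers of eigenvalues (with geometric multiplicity) of modulus `< 1`, `= 1` and `> 1` of an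
endomorphism: the numbers of contracting, marginal and expanding directions. It is
used for endomorphisms that are diagonalizable over `ℝ`. -/
def spectralType {V : Type*} [AddCommGroup V] [Module ℝ V] (L : Module.End ℝ V) : ℕ × ℕ × ℕ :=
  (Module.finrank ℝ ↥(⨆ μ ∈ {μ : ℝ | |μ| < 1}, L.eigenspace μ),
   Module.finrank ℝ ↥(⨆ μ ∈ {μ : ℝ | |μ| = 1}, L.eigenspace μ),
   Module.finrank ℝ ↥(⨆ μ ∈ {μ : ℝ | 1 < |μ|}, L.eigenspace μ))

/-- The stability type of a fixed point `p` of `F : ∂C → ∂C`, read off from the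
differential `DF(p)`, viewed as an endomorphism of `T_p ∂C`. -/
def stabilityType {N : ℕ} {C : Set (Euc N)} (F : frontier C → frontier C) (p : frontier C) :
    ℕ × ℕ × ℕ :=
  spectralType (tangentProj C p ∘L surfaceDeriv (fun y : frontier C => (F y : Euc N)) p :
    tangentSpace C p →ₗ[ℝ] tangentSpace C p)

end

end ReturnMap

/-! Write `ν` for the outward normal and `B = I - d S` for the radial operator. With this sign
convention convexity makes `S` negative semidefinite, so `B` is symmetric with `B ≥ I`, hence
invertible. Where `d` is differentiable, `Φ` has differential `v ↦ B v + (Dd v) ν`. As `Φ` takes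
values in `∂Ω`, the inward normal `n` at `Φ(c)` satisfies the key identity `⟪n, B v⟫ + (Dd v) ⟪n, ν⟫
= 0` (`inner_inwardNormal_eq_zero`). Thus `n` is a positive multiple of `w - ν`, where `w = B⁻¹ ∇d`
is the tilt.

Fixed points: `F c = c` means that `n = -ν`. At a critical point the identity forces this.
Conversely, if `n = -ν`, then to first order `Ω` is a half-space orthogonal to `ν(c)` at `Φ(c)`;
since normal rays meet `Ω` in intervals, `d(y) = d(c) + o(|y - c|)`, with no regularity of `d`
presupposed.

Linearization: `F y = y + (d - s) ν + s w`, where `s` is the first hitting parameter. At a fixed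
point `w = 0`, which gives `s - d = o(|y - p|)`, and the differential of `w` is `B⁻¹ Hess d`; hence
`DF = I + d B⁻¹ Hess d`. Since `B ∘ DF = B + d Hess d` is symmetric, `DF` is self-adjoint for the
inner product `⟪B x, y⟫`, so it is diagonalizable over `ℝ`. In eigencoordinates with the sup norm,
stability is a contraction estimate and instability follows from a forward invariant expanding cone;
differentiability of `F` at the single point `p` suffices.

Basins: along an orbit tending to `p`, `F c - Φ(c)` is a multiple of `n` and tends to `-d(p) ν(p)`.
For `d` of class `C¹` the key identity, multiplied by that factor, passes to the limit and gives
`Dd(p) = 0`. The other basin statements are formal. -/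

namespace ReturnMap

/-! ### Calculus in the ambient space -/

/-- The gradient of a `C²` function is `C¹`. -/
theorem contDiffAt_gradient {N : ℕ} {φ : Euc N → ℝ} {c : Euc N} (h : ContDiffAt ℝ 2 φ c) :
    ContDiffAt ℝ 1 (gradient φ) c := by
  let R : (Euc N →L[ℝ] ℝ) →L[ℝ] Euc N := LinearMap.toContinuousLinearMap
    { toFun := (InnerProductSpace.toDual ℝ (Euc N)).symm
      map_add' := fun x y => map_add _ x y
      map_smul' := fun a x => by simp }
  exact R.contDiff.contDiffAt.comp c (h.fderiv_right (m := 1) (by norm_num))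

/-- The differential of the gradient of a `C²` function is symmetric. -/
theorem inner_fderiv_gradient_comm {N : ℕ} {φ : Euc N → ℝ} {c : Euc N} (h : ContDiffAt ℝ 2 φ c)
    (v w : Euc N) :
    ⟪fderiv ℝ (gradient φ) c v, w⟫ = ⟪v, fderiv ℝ (gradient φ) c w⟫ := by
  have hd : DifferentiableAt ℝ (gradient φ) c :=
    (contDiffAt_gradient h).differentiableAt (by norm_num)
  have hd' : DifferentiableAt ℝ (fderiv ℝ φ) c :=
    (h.fderiv_right (m := 1) (by norm_num)).differentiableAt (by norm_num)
  have key : ∀ v w : Euc N, ⟪fderiv ℝ (gradient φ) c v, w⟫ = fderiv ℝ (fderiv ℝ φ) c v w := by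
    intro v w
    have h1 : HasFDerivAt (fun y => ⟪gradient φ y, w⟫) _ c :=
      hd.hasFDerivAt.inner ℝ (hasFDerivAt_const w c)
    have h2 : HasFDerivAt (fun y => fderiv ℝ φ y w) _ c :=
      hd'.hasFDerivAt.clm_apply (hasFDerivAt_const w c)
    simp only [inner_gradient_left] at h1
    have := congrArg (fun L : Euc N →L[ℝ] ℝ => L v) (h1.unique h2)
    simpa using this
  rw [key, real_inner_comm, key]
  exact (h.isSymmSndFDerivAt (by simp)) v w

theorem inner_fderiv_self_of_norm_eq_one {N : ℕ} {G : Euc N → Euc N} {y : Euc N}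
    (hG : DifferentiableAt ℝ G y) (h : ∀ᶠ z in 𝓝 y, ‖G z‖ = 1) (v : Euc N) :
    ⟪G y, fderiv ℝ G y v⟫ = 0 := by
  have h1 : HasFDerivAt (fun z => ⟪G z, G z⟫) _ y := hG.hasFDerivAt.inner ℝ hG.hasFDerivAt
  have h2 : HasFDerivAt (fun z => ⟪G z, G z⟫) (0 : Euc N →L[ℝ] ℝ) y := by
    refine (hasFDerivAt_const (1 : ℝ) y).congr_of_eventuallyEq ?_
    filter_upwards [h] with z hz
    rw [real_inner_self_eq_norm_sq, hz]; norm_num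
  have := congrArg (fun L : Euc N →L[ℝ] ℝ => L v) (h1.unique h2)
  simpa [real_inner_comm] using this

/-! ### The outward normal of a convex core and its local extension -/

section Core

variable {N : ℕ} {C : Set (Euc N)}

theorem IsConvexCore.frontier_subset (hC : IsConvexCore C) : frontier C ⊆ C :=
  hC.isCompact.isClosed.frontier_subset

/-- Directions of strict decrease of a defining function point into the set. -/
theorem eventually_mem_of_inner_gradient_neg {φ : Euc N → ℝ} {c v : Euc N}
    (hd : DifferentiableAt ℝ φ c) (h0 : φ c ≤ 0) (hev : ∀ᶠ y in 𝓝 c, (y ∈ C ↔ φ y ≤ 0))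
    (hv : ⟪gradient φ c, v⟫ < 0) : ∀ᶠ t : ℝ in 𝓝[>] 0, c + t • v ∈ C := by
  have hcv : HasDerivAt (fun t : ℝ => c + t • v) v 0 := by
    simpa using ((hasDerivAt_id (0 : ℝ)).smul_const v).const_add c
  have h1 : HasDerivAt (fun t : ℝ => φ (c + t • v)) ⟪gradient φ c, v⟫ 0 := by
    rw [inner_gradient_left]
    have : HasFDerivAt φ (fderiv ℝ φ c) (c + (0 : ℝ) • v) := by simpa using hd.hasFDerivAt
    exact this.comp_hasDerivAt (0 : ℝ) hcv
  have h2 := h1.tendsto_slope_zero_right.eventually (gt_mem_nhds hv)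
  have h3 : Tendsto (fun t : ℝ => c + t • v) (𝓝[>] 0) (𝓝 c) := by
    have := hcv.continuousAt.tendsto.mono_left (nhdsWithin_le_nhds (s := Ioi (0 : ℝ)))
    simpa using this
  filter_upwards [h2, h3.eventually hev, self_mem_nhdsWithin] with t ht ht2 ht0
  rw [ht2]
  have ht0' : (0 : ℝ) < t := ht0
  simp only [zero_add, zero_smul, add_zero, smul_eq_mul] at ht
  have := (inv_mul_lt_iff₀ ht0').1 ht
  linarith

/-- At a boundary point, the outward unit normal is the normalized gradient of a defining
function. -/
theorem isOutwardUnitNormal_iff (hC : IsConvexCore C) {φ : Euc N → ℝ} {c : Euc N}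
    (hc : c ∈ frontier C) (hd : DifferentiableAt ℝ φ c) (hne : gradient φ c ≠ 0)
    (hev : ∀ᶠ y in 𝓝 c, (y ∈ C ↔ φ y ≤ 0)) (u : Euc N) :
    IsOutwardUnitNormal C c u ↔ u = ‖gradient φ c‖⁻¹ • gradient φ c := by
  have hcC := hC.frontier_subset hc
  have h0 : φ c ≤ 0 := hev.self_of_nhds.1 hcC
  have hpos : 0 < ‖gradient φ c‖ := norm_pos_iff.2 hne
  set g := gradient φ c with hg
  have hzero : φ c = 0 := by
    by_contra h
    have hlt : φ c < 0 := lt_of_le_of_ne h0 h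
    have : ∀ᶠ y in 𝓝 c, y ∈ C := by
      filter_upwards [hev, hd.continuousAt.eventually (gt_mem_nhds hlt)] with y h1 h2
      exact h1.2 h2.le
    exact hc.2 (mem_interior_iff_mem_nhds.2 this)
  constructor
  · rintro ⟨hu, hle⟩
    have key : ∀ w : Euc N, ⟪g, w⟫ < 0 → ⟪u, w⟫ ≤ 0 := by
      intro w hw
      obtain ⟨t, ht, ht0⟩ := ((eventually_mem_of_inner_gradient_neg hd h0 hev hw).and
        self_mem_nhdsWithin).exists
      have := hle _ ht
      rw [add_sub_cancel_left, inner_smul_right] at this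
      exact nonpos_of_mul_nonpos_right this ht0
    have key2 : ∀ w : Euc N, ⟪g, w⟫ ≤ 0 → ⟪u, w⟫ ≤ 0 := by
      intro w hw
      by_contra! h
      -- Subtracting a small multiple of `g` makes `⟪g, w⟫` strictly negative. The coefficient is
      -- small enough that `⟪u, w⟫` loses at most half its value.
      have h1 := key (w - (⟪u, w⟫ / (2 * (|⟪u, g⟫| + 1))) • g) (by
        rw [inner_sub_right, inner_smul_right, real_inner_self_eq_norm_sq]
        have : 0 < ⟪u, w⟫ / (2 * (|⟪u, g⟫| + 1)) * ‖g‖ ^ 2 := by positivity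
        linarith)
      rw [inner_sub_right, inner_smul_right] at h1
      have h2 : ⟪u, w⟫ / (2 * (|⟪u, g⟫| + 1)) * ⟪u, g⟫ ≤ ⟪u, w⟫ / 2 := by
        rw [div_mul_eq_mul_div, div_le_div_iff₀ (by positivity) (by norm_num)]
        nlinarith [le_abs_self ⟪u, g⟫]
      linarith
    -- The component `w` of `u` orthogonal to `g` is itself an admissible test vector, so `‖w‖² =
    -- ⟪u, w⟫ ≤ 0`.
    have hperp : u - (⟪g, u⟫ / ‖g‖ ^ 2) • g = 0 := by
      set w := u - (⟪g, u⟫ / ‖g‖ ^ 2) • g with hw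
      have h1 : ⟪g, w⟫ = 0 := by
        rw [hw, inner_sub_right, inner_smul_right, real_inner_self_eq_norm_sq]
        field_simp
        ring
      have h2 := key2 w h1.le
      have h3 : ⟪w, w⟫ = ⟪u, w⟫ := by
        have h5 : ⟪w, w⟫ = ⟪u, w⟫ - ⟪g, u⟫ / ‖g‖ ^ 2 * ⟪g, w⟫ := by
          conv_lhs => enter [2]; rw [hw]
          rw [inner_sub_left, real_inner_smul_left]
        rw [h5, h1, mul_zero, sub_zero]
      have h4 : ⟪w, w⟫ ≤ 0 := h3.trans_le h2
      rw [real_inner_self_eq_norm_sq] at h4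
      exact norm_eq_zero.1 (pow_eq_zero_iff two_ne_zero |>.1 (le_antisymm h4 (sq_nonneg _)))
    have hu' : u = (⟪g, u⟫ / ‖g‖ ^ 2) • g := sub_eq_zero.1 hperp
    have hge : 0 ≤ ⟪g, u⟫ / ‖g‖ ^ 2 := by
      have h5 := key2 (-g) (by rw [inner_neg_right, neg_nonpos]; exact real_inner_self_nonneg)
      rw [inner_neg_right, neg_nonpos, real_inner_comm] at h5
      positivity
    have h6 : ⟪g, u⟫ / ‖g‖ ^ 2 * ‖g‖ = 1 := by
      have := hu
      rw [hu', norm_smul, Real.norm_of_nonneg hge] at this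
      exact this
    rw [← eq_inv_of_mul_eq_one_left h6]
    exact hu'
  · rintro rfl
    refine ⟨by rw [norm_smul, norm_inv, norm_norm, inv_mul_cancel₀ hpos.ne'], fun y hy => ?_⟩
    rw [inner_smul_left]
    refine mul_nonpos_of_nonneg_of_nonpos (by simp) ?_
    by_contra! h
    have hneg : ∀ᶠ t : ℝ in 𝓝[>] 0, c + t • (y - c) ∈ C := by
      filter_upwards [Ioo_mem_nhdsGT (show (0 : ℝ) < 1 by norm_num)] with t ht
      have := hC.convex.add_smul_sub_mem hcC hy ⟨ht.1.le, ht.2.le⟩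
      exact this
    have hcv : HasDerivAt (fun t : ℝ => c + t • (y - c)) (y - c) 0 := by
      simpa using ((hasDerivAt_id (0 : ℝ)).smul_const (y - c)).const_add c
    have h1 : HasDerivAt (fun t : ℝ => φ (c + t • (y - c))) ⟪g, y - c⟫ 0 := by
      rw [hg, inner_gradient_left]
      have : HasFDerivAt φ (fderiv ℝ φ c) (c + (0 : ℝ) • (y - c)) := by simpa using hd.hasFDerivAt
      exact this.comp_hasDerivAt (0 : ℝ) hcv
    have h2 := h1.tendsto_slope_zero_right.eventually (lt_mem_nhds h)
    have h3 : Tendsto (fun t : ℝ => c + t • (y - c)) (𝓝[>] 0) (𝓝 c) := by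
      have := hcv.continuousAt.tendsto.mono_left (nhdsWithin_le_nhds (s := Ioi (0 : ℝ)))
      simpa using this
    obtain ⟨t, h4, h5, h6, h7⟩ := (h2.and (hneg.and ((h3.eventually hev).and
      self_mem_nhdsWithin))).exists
    have h8 : φ (c + t • (y - c)) ≤ 0 := h6.1 h5
    simp only [zero_add, zero_smul, add_zero, smul_eq_mul, hzero, sub_zero] at h4
    have h9 : (0 : ℝ) < t⁻¹ := inv_pos.2 h7
    exact absurd h4 (not_lt.2 (mul_nonpos_of_nonneg_of_nonpos h9.le h8))

theorem IsConvexCore.exists_defining (hC : IsConvexCore C) {c : Euc N} (hc : c ∈ frontier C) :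
    ∃ φ : Euc N → ℝ, ContDiffAt ℝ 2 φ c ∧ gradient φ c ≠ 0 ∧
      ∀ᶠ y in 𝓝 c, (y ∈ C ↔ φ y ≤ 0) := by
  obtain ⟨φ, h1, h2, h3⟩ := hC.hasC2Boundary c hc
  refine ⟨φ, h1, fun h => h2 ?_, h3⟩
  rw [← toDual_gradient, h, map_zero]

theorem IsConvexCore.isOutwardUnitNormal (hC : IsConvexCore C) {c : Euc N}
    (hc : c ∈ frontier C) : IsOutwardUnitNormal C c (outwardNormal C c) := by
  obtain ⟨φ, h1, h2, h3⟩ := hC.exists_defining hc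
  exact Classical.epsilon_spec (p := IsOutwardUnitNormal C c)
    ⟨_, (isOutwardUnitNormal_iff hC hc (h1.differentiableAt (by norm_num)) h2 h3 _).2 rfl⟩

theorem IsConvexCore.norm_outwardNormal (hC : IsConvexCore C) {c : Euc N}
    (hc : c ∈ frontier C) : ‖outwardNormal C c‖ = 1 :=
  (hC.isOutwardUnitNormal hc).1

theorem IsConvexCore.inner_outwardNormal_le (hC : IsConvexCore C) {c y : Euc N}
    (hc : c ∈ frontier C) (hy : y ∈ C) : ⟪outwardNormal C c, y - c⟫ ≤ 0 :=
  (hC.isOutwardUnitNormal hc).2 y hy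

theorem IsConvexCore.outwardNormal_eq (hC : IsConvexCore C) {φ : Euc N → ℝ} {c : Euc N}
    (hc : c ∈ frontier C) (hd : DifferentiableAt ℝ φ c) (hne : gradient φ c ≠ 0)
    (hev : ∀ᶠ y in 𝓝 c, (y ∈ C ↔ φ y ≤ 0)) :
    outwardNormal C c = ‖gradient φ c‖⁻¹ • gradient φ c :=
  (isOutwardUnitNormal_iff hC hc hd hne hev _).1 (hC.isOutwardUnitNormal hc)

/-- `G` is a local `C¹` extension of the outward unit normal around `c`: a unit field whose
differential is symmetric on the tangent spaces. -/
structure IsNormalExtension (C : Set (Euc N)) (c : Euc N) (G : Euc N → Euc N) : Prop where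
  contDiffAt : ContDiffAt ℝ 1 G c
  eq_outwardNormal : ∀ᶠ y in 𝓝 c, y ∈ frontier C → outwardNormal C y = G y
  norm_eq_one : ∀ᶠ y in 𝓝 c, ‖G y‖ = 1
  symm : ∀ᶠ y in 𝓝 c, ∀ v w, ⟪G y, v⟫ = 0 → ⟪G y, w⟫ = 0 →
    ⟪fderiv ℝ G y v, w⟫ = ⟪v, fderiv ℝ G y w⟫

theorem eventually_differentiableAt_of_contDiffAt {V : Type*} [NormedAddCommGroup V]
    [NormedSpace ℝ V] {G : Euc N → V} {c : Euc N} (h : ContDiffAt ℝ 1 G c) :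
    ∀ᶠ y in 𝓝 c, DifferentiableAt ℝ G y :=
  (h.eventually (by simp)).mono fun _ hy => hy.differentiableAt (by norm_num)

/-- The normalized gradient of a defining function serves at all nearby points at once, because the
same function defines `C` near each of them. -/
theorem IsConvexCore.exists_normalExtension (hC : IsConvexCore C) {c : Euc N}
    (hc : c ∈ frontier C) : ∃ G : Euc N → Euc N, IsNormalExtension C c G := by
  obtain ⟨φ, h1, h2, h3⟩ := hC.exists_defining hc
  have hg := contDiffAt_gradient h1
  have hne : ∀ᶠ y in 𝓝 c, gradient φ y ≠ 0 := hg.continuousAt.eventually_ne h2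
  have h1' : ∀ᶠ y in 𝓝 c, ContDiffAt ℝ 2 φ y := h1.eventually (by simp)
  have hr : ∀ y, ContDiffAt ℝ 2 φ y → gradient φ y ≠ 0 →
      ContDiffAt ℝ 1 (fun y => ‖gradient φ y‖⁻¹) y := fun y hy hy' =>
    ((contDiffAt_gradient hy).norm ℝ hy').inv (norm_ne_zero_iff.2 hy')
  refine ⟨fun y => ‖gradient φ y‖⁻¹ • gradient φ y, (hr c h1 h2).smul hg, ?_, ?_, ?_⟩
  · filter_upwards [hne, h1', eventually_eventually_nhds.2 h3] with y ha hb hd hy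
    exact hC.outwardNormal_eq hy (hb.differentiableAt (by norm_num)) ha hd
  · filter_upwards [hne] with y ha
    rw [norm_smul, norm_inv, norm_norm, inv_mul_cancel₀ (norm_ne_zero_iff.2 ha)]
  · filter_upwards [hne, h1'] with y ha hb v w hv hw
    have hpos : ‖gradient φ y‖⁻¹ ≠ 0 := inv_ne_zero (norm_ne_zero_iff.2 ha)
    have hv' : ⟪gradient φ y, v⟫ = 0 := by
      rw [inner_smul_left] at hv
      exact (mul_eq_zero.1 hv).resolve_left (by simpa using ha)
    have hw' : ⟪gradient φ y, w⟫ = 0 := by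
      rw [inner_smul_left] at hw
      exact (mul_eq_zero.1 hw).resolve_left (by simpa using ha)
    -- The derivative of the normalizing factor contributes a multiple of `∇φ`, which tangent
    -- vectors do not see; what remains is a multiple of the symmetric second derivative.
    have hder := ((hr y hb ha).differentiableAt (by norm_num)).hasFDerivAt.smul
      ((contDiffAt_gradient hb).differentiableAt (by norm_num)).hasFDerivAt
    have hder' := hder.fderiv
    rw [show fderiv ℝ (fun y => ‖gradient φ y‖⁻¹ • gradient φ y) y = _ from hder']
    simp only [add_apply, smul_apply,
      ContinuousLinearMap.smulRight_apply, inner_add_left, inner_add_right, inner_smul_left,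
      inner_smul_right, hw', real_inner_comm (gradient φ y) v ▸ hv', mul_zero, add_zero]
    rw [inner_fderiv_gradient_comm hb]
    simp

/-- First order interior condition, uniform in the boundary point. -/
theorem IsConvexCore.eventually_mem (hC : IsConvexCore C) {p : Euc N} (hp : p ∈ frontier C)
    {ε : ℝ} (hε : 0 < ε) : ∀ᶠ q : Euc N × Euc N in 𝓝 (p, p), q.1 ∈ frontier C →
      ⟪outwardNormal C p, q.2 - q.1⟫ ≤ -(ε * ‖q.2 - q.1‖) → q.2 ∈ C := by
  obtain ⟨φ, h1, h2, h3⟩ := hC.exists_defining hp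
  have hpos : 0 < ‖gradient φ p‖ := norm_pos_iff.2 h2
  -- Strict differentiability lets both points vary, hence the uniformity in the boundary point.
  have hs : HasStrictFDerivAt φ (fderiv ℝ φ p) p := h1.hasStrictFDerivAt (by norm_num)
  have h4 := hs.isLittleO.def (c := ε * ‖gradient φ p‖) (by positivity)
  have hfst : Tendsto (Prod.fst : Euc N × Euc N → Euc N) (𝓝 (p, p)) (𝓝 p) :=
    continuous_fst.tendsto (p, p)
  have hsnd : Tendsto (Prod.snd : Euc N × Euc N → Euc N) (𝓝 (p, p)) (𝓝 p) :=
    continuous_snd.tendsto (p, p)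
  filter_upwards [h4.filter_mono le_rfl, hfst.eventually h3, hsnd.eventually h3] with q hq hq1 hq2
    hqf hin
  rw [hq2]
  have h5 : φ q.1 ≤ 0 := hq1.1 (hC.frontier_subset hqf)
  rw [hC.outwardNormal_eq hp (h1.differentiableAt (by norm_num)) h2 h3, inner_smul_left,
    inner_gradient_left] at hin
  have h6 : fderiv ℝ φ p (q.2 - q.1) ≤ -(ε * ‖gradient φ p‖ * ‖q.2 - q.1‖) := by
    have : ‖gradient φ p‖⁻¹ * fderiv ℝ φ p (q.2 - q.1) ≤ -(ε * ‖q.2 - q.1‖) := by simpa using hin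
    rw [inv_mul_le_iff₀ hpos] at this
    linarith
  have h7 := (abs_le.1 (by simpa [Real.norm_eq_abs] using hq)).1
  rw [map_sub] at h6
  rw [norm_sub_rev] at h7
  linarith

end Core

/-! ### Differential calculus on the boundary hypersurface -/

section Surface

variable {N : ℕ} {C : Set (Euc N)}

theorem mem_tangentSpace_iff {c : frontier C} {v : Euc N} :
    v ∈ tangentSpace C c ↔ ⟪outwardNormal C (c : Euc N), v⟫ = 0 :=
  Submodule.mem_orthogonal_singleton_iff_inner_right

theorem inner_outwardNormal_coe (c : frontier C) (v : tangentSpace C c) :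
    ⟪outwardNormal C (c : Euc N), (v : Euc N)⟫ = 0 :=
  mem_tangentSpace_iff.1 v.2

theorem IsConvexCore.coe_tangentProj (hC : IsConvexCore C) (c : frontier C) (x : Euc N) :
    (tangentProj C c x : Euc N)
      = x - ⟪outwardNormal C (c : Euc N), x⟫ • outwardNormal C (c : Euc N) := by
  unfold tangentProj tangentSpace
  change (Submodule.starProjection _ x) = _
  rw [Submodule.starProjection_orthogonal_val]
  rw [Submodule.starProjection_unit_singleton ℝ (hC.norm_outwardNormal c.2)]

theorem tangentProj_coe (c : frontier C) (v : tangentSpace C c) :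
    tangentProj C c (v : Euc N) = v :=
  Submodule.orthogonalProjectionOnto_mem_subspace_eq_self v

theorem inner_tangentProj (c : frontier C) (x : Euc N) (v : tangentSpace C c) :
    ⟪tangentProj C c x, v⟫ = ⟪x, (v : Euc N)⟫ :=
  Submodule.inner_orthogonalProjectionOnto_eq_of_mem_right v x

/-- Every tangent vector is the velocity of a curve in the boundary. -/
theorem IsConvexCore.exists_curve (hC : IsConvexCore C) (c : frontier C) (v : tangentSpace C c) :
    ∃ γ : ℝ → frontier C, γ 0 = c ∧
      HasDerivWithinAt (fun t => (γ t : Euc N)) (v : Euc N) (Ioi 0) 0 := by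
  classical
  obtain ⟨c, hc⟩ := c
  obtain ⟨v, hv⟩ := v
  rw [mem_tangentSpace_iff] at hv
  simp only at hv ⊢
  set ν := outwardNormal C c with hν
  have hν1 : ‖ν‖ = 1 := hC.norm_outwardNormal hc
  -- Heights of the points of `C` over `c + t v`, measured along `ν`. The curve follows the top of
  -- each column; convexity bounds the heights by `0`, and the first order interior condition bounds
  -- the top below by `-ε t`.
  let S : ℝ → Set ℝ := fun t => {s | c + t • v + s • ν ∈ C}
  have hcont : ∀ t : ℝ, Continuous fun s : ℝ => c + t • v + s • ν := fun t => by fun_prop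
  have hclosed : ∀ t, IsClosed (S t) := fun t => hC.isCompact.isClosed.preimage (hcont t)
  have hub : ∀ t, ∀ s ∈ S t, s ≤ 0 := by
    intro t s hs
    have := hC.inner_outwardNormal_le hc hs
    rw [add_assoc, add_sub_cancel_left, ← hν, inner_add_right, inner_smul_right, inner_smul_right,
      hv, real_inner_self_eq_norm_sq, hν1] at this
    linarith
  have hbdd : ∀ t, BddAbove (S t) := fun t => ⟨0, fun s hs => hub t s hs⟩
  have hlow : ∀ ε > (0 : ℝ), ∀ᶠ t : ℝ in 𝓝[>] 0, -(ε * t) ∈ S t := by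
    intro ε hε
    have h1 := hC.eventually_mem hc (ε := ε / (‖v‖ + ε)) (by positivity)
    have h2 : Tendsto (fun t : ℝ => (c, c + t • v + (-(ε * t)) • ν)) (𝓝[>] 0) (𝓝 (c, c)) := by
      refine Tendsto.mono_left ?_ nhdsWithin_le_nhds
      have : Continuous (fun t : ℝ => (c, c + t • v + (-(ε * t)) • ν)) := by fun_prop
      simpa using this.tendsto 0
    filter_upwards [h2.eventually h1, self_mem_nhdsWithin] with t ht ht0
    have ht0 : (0 : ℝ) < t := ht0
    refine ht hc ?_
    rw [add_assoc, add_sub_cancel_left, ← hν, inner_add_right, inner_smul_right, inner_smul_right,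
      hv, real_inner_self_eq_norm_sq, hν1]
    have : ‖t • v + (-(ε * t)) • ν‖ ≤ t * (‖v‖ + ε) := by
      refine (norm_add_le _ _).trans ?_
      rw [norm_smul, norm_smul, hν1, Real.norm_of_nonneg ht0.le, norm_neg,
        Real.norm_of_nonneg (by positivity)]
      linarith
    have h3 : ε / (‖v‖ + ε) * ‖t • v + (-(ε * t)) • ν‖ ≤ ε / (‖v‖ + ε) * (t * (‖v‖ + ε)) := by
      gcongr
    have h4 : ε / (‖v‖ + ε) * (t * (‖v‖ + ε)) = ε * t := by field_simp
    linarith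
  let γ₀ : ℝ → Euc N := fun t => c + t • v + sSup (S t) • ν
  have hfr : ∀ᶠ t : ℝ in 𝓝[>] 0, γ₀ t ∈ frontier C := by
    filter_upwards [hlow 1 one_pos] with t ht
    have hmem : sSup (S t) ∈ S t := (hclosed t).csSup_mem ⟨_, ht⟩ (hbdd t)
    rw [hC.isCompact.isClosed.frontier_eq]
    refine ⟨hmem, fun hint => ?_⟩
    have h5 : ∀ᶠ s in 𝓝 (sSup (S t)), s ∈ S t :=
      (hcont t).continuousAt.eventually (mem_interior_iff_mem_nhds.1 hint)
    have h6 : ∀ᶠ s in 𝓝[>] (sSup (S t)), s ∈ S t := h5.filter_mono nhdsWithin_le_nhds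
    obtain ⟨s, hs, hs'⟩ := (h6.and self_mem_nhdsWithin).exists
    exact absurd (le_csSup (hbdd t) hs) (not_le.2 hs')
  have hs0 : (fun t => sSup (S t) • ν) =o[𝓝[>] 0] fun t : ℝ => t := by
    rw [Asymptotics.isLittleO_iff]
    intro ε hε
    filter_upwards [hlow ε hε, self_mem_nhdsWithin] with t ht ht0
    have h7 : -(ε * t) ≤ sSup (S t) := le_csSup (hbdd t) ht
    have h8 : sSup (S t) ≤ 0 := csSup_le ⟨_, ht⟩ (hub t)
    rw [norm_smul, hν1, mul_one, Real.norm_eq_abs, Real.norm_of_nonneg (le_of_lt ht0), abs_le]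
    constructor <;> linarith [mul_pos hε ht0]
  -- The value `c` is a filler for parameters where the top of the column is not known to be a
  -- boundary point; only small positive `t` matter.
  refine ⟨fun t => if h : 0 < t ∧ γ₀ t ∈ frontier C then ⟨γ₀ t, h.2⟩ else ⟨c, hc⟩, by simp, ?_⟩
  rw [hasDerivWithinAt_iff_isLittleO]
  refine hs0.congr' ?_ (by simp)
  filter_upwards [hfr, self_mem_nhdsWithin] with t ht ht0
  have ht0 : 0 < t := ht0
  simp only [ht0, ht, and_self, dite_true, lt_irrefl, false_and, dite_false, sub_zero, γ₀]
  module

theorem tendsto_of_curve {c : frontier C} {v : Euc N} {γ : ℝ → frontier C} (h0 : γ 0 = c)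
    (h : HasDerivWithinAt (fun t => (γ t : Euc N)) v (Ioi 0) 0) :
    Tendsto γ (𝓝[>] 0) (𝓝 c) := by
  rw [tendsto_subtype_rng]
  have := h.continuousWithinAt.tendsto
  rwa [h0] at this

theorem HasSurfaceDerivAt.comp_curve {V : Type*} [NormedAddCommGroup V] [NormedSpace ℝ V]
    {f : frontier C → V} {c : frontier C} {L : tangentSpace C c →L[ℝ] V}
    (hf : HasSurfaceDerivAt f c L) {v : tangentSpace C c} {γ : ℝ → frontier C} (h0 : γ 0 = c)
    (h : HasDerivWithinAt (fun t => (γ t : Euc N)) (v : Euc N) (Ioi 0) 0) :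
    HasDerivWithinAt (fun t => f (γ t)) (L v) (Ioi 0) 0 := by
  rw [hasDerivWithinAt_iff_isLittleO]
  have h1 := (hasDerivWithinAt_iff_isLittleO.1 h)
  have hO : (fun t => (γ t : Euc N) - c) =O[𝓝[>] 0] fun t : ℝ => t - 0 := by
    have := h.hasFDerivWithinAt.isBigO_sub
    simpa [h0] using this
  have h2 := (hf.comp_tendsto (tendsto_of_curve h0 h)).trans_isBigO hO
  have h3 := ((L ∘L tangentProj C c).isBigO_comp _ _).trans_isLittleO h1
  refine (h2.add h3).congr_left fun t => ?_
  simp only [Function.comp, h0, ContinuousLinearMap.comp_apply, map_sub, map_smul, tangentProj_coe]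
  abel

/-- Every tangent vector is a one-sided velocity, so the values of a differential are one-sided
derivatives along curves. This identifies `surfaceDeriv`, defined by choice, with any computed
differential. -/
theorem HasSurfaceDerivAt.unique (hC : IsConvexCore C) {V : Type*} [NormedAddCommGroup V]
    [NormedSpace ℝ V] {f : frontier C → V} {c : frontier C} {L L' : tangentSpace C c →L[ℝ] V}
    (h : HasSurfaceDerivAt f c L) (h' : HasSurfaceDerivAt f c L') : L = L' := by
  ext v
  obtain ⟨γ, h0, hγ⟩ := hC.exists_curve c v
  exact (uniqueDiffWithinAt_Ioi (0 : ℝ)).eq_deriv _ (h.comp_curve h0 hγ) (h'.comp_curve h0 hγ)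

theorem HasSurfaceDerivAt.surfaceDeriv_eq (hC : IsConvexCore C) {V : Type*}
    [NormedAddCommGroup V] [NormedSpace ℝ V] {f : frontier C → V} {c : frontier C}
    {L : tangentSpace C c →L[ℝ] V} (h : HasSurfaceDerivAt f c L) : surfaceDeriv f c = L := by
  have hex : ∃ L, HasSurfaceDerivAt f c L := ⟨L, h⟩
  unfold surfaceDeriv
  rw [dif_pos hex]
  exact hex.choose_spec.unique hC h

theorem IsNormalExtension.eventually_eq {G : Euc N → Euc N} {c : frontier C}
    (hG : IsNormalExtension C (c : Euc N) G) :
    ∀ᶠ y : frontier C in 𝓝 c, outwardNormal C (y : Euc N) = G y := by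
  filter_upwards [continuous_subtype_val.continuousAt.eventually hG.eq_outwardNormal] with y hy
  exact hy y.2

theorem IsNormalExtension.eq_self {G : Euc N → Euc N} {c : frontier C}
    (hG : IsNormalExtension C (c : Euc N) G) : outwardNormal C (c : Euc N) = G c :=
  hG.eq_outwardNormal.self_of_nhds c.2

theorem IsConvexCore.continuous_outwardNormal (hC : IsConvexCore C) :
    Continuous fun y : frontier C => outwardNormal C (y : Euc N) := by
  rw [continuous_iff_continuousAt]
  intro c
  obtain ⟨G, hG⟩ := hC.exists_normalExtension c.2
  have h1 : ContinuousAt (fun y : frontier C => G y) c :=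
    ContinuousAt.comp (f := ((↑) : frontier C → Euc N)) hG.contDiffAt.continuousAt
      continuous_subtype_val.continuousAt
  refine h1.congr ?_
  filter_upwards [IsNormalExtension.eventually_eq hG] with y hy using hy.symm

/-- Sum of the two supporting half-space inequalities. -/
theorem IsConvexCore.monotone_outwardNormal (hC : IsConvexCore C) (c y : frontier C) :
    0 ≤ ⟪outwardNormal C (y : Euc N) - outwardNormal C (c : Euc N), (y : Euc N) - c⟫ := by
  have h1 := hC.inner_outwardNormal_le c.2 (hC.frontier_subset y.2)
  have h2 := hC.inner_outwardNormal_le y.2 (hC.frontier_subset c.2)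
  rw [← neg_sub, inner_neg_right] at h2
  rw [inner_sub_left]
  linarith

/-- Boundary points lie, to first order, in the tangent space. -/
theorem IsConvexCore.isLittleO_inner_outwardNormal (hC : IsConvexCore C) (c : frontier C) :
    (fun y : frontier C => ⟪outwardNormal C (c : Euc N), (y : Euc N) - c⟫)
      =o[𝓝 c] fun y : frontier C => (y : Euc N) - c := by
  rw [Asymptotics.isLittleO_iff]
  intro ε hε
  have h1 : Tendsto (fun y : frontier C =>
      ‖outwardNormal C (y : Euc N) - outwardNormal C (c : Euc N)‖) (𝓝 c) (𝓝 0) := by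
    have := ((hC.continuous_outwardNormal.tendsto c).sub_const (outwardNormal C (c : Euc N))).norm
    simpa using this
  filter_upwards [h1.eventually (gt_mem_nhds hε)] with y hy
  have h2 := hC.inner_outwardNormal_le c.2 (hC.frontier_subset y.2)
  have h3 := hC.inner_outwardNormal_le y.2 (hC.frontier_subset c.2)
  rw [← neg_sub, inner_neg_right] at h3
  have h4 := real_inner_le_norm (outwardNormal C (y : Euc N) - outwardNormal C (c : Euc N))
    ((y : Euc N) - c)
  rw [inner_sub_left] at h4
  have h5 := mul_le_mul_of_nonneg_right hy.le (norm_nonneg ((y : Euc N) - c))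
  rw [Real.norm_eq_abs, abs_of_nonpos h2]
  linarith

theorem IsConvexCore.isLittleO_sub_tangentProj (hC : IsConvexCore C) (c : frontier C) :
    (fun y : frontier C => (y : Euc N) - c - (tangentProj C c ((y : Euc N) - c) : Euc N))
      =o[𝓝 c] fun y : frontier C => (y : Euc N) - c := by
  refine Asymptotics.IsLittleO.congr_left (f₁ := fun y : frontier C =>
    ⟪outwardNormal C (c : Euc N), (y : Euc N) - c⟫ • outwardNormal C (c : Euc N)) ?_ ?_
  · refine Asymptotics.IsLittleO.of_norm_left ?_
    simp only [norm_smul, hC.norm_outwardNormal c.2, mul_one]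
    exact (hC.isLittleO_inner_outwardNormal c).norm_left
  · intro y
    rw [hC.coe_tangentProj]
    abel

/-- Restrictions of differentiable maps of the ambient space are differentiable. -/
theorem IsConvexCore.hasSurfaceDerivAt (hC : IsConvexCore C) {V : Type*}
    [NormedAddCommGroup V] [NormedSpace ℝ V] {f : frontier C → V} {c : frontier C}
    {g : Euc N → V} {g' : Euc N →L[ℝ] V} (hg : HasFDerivAt g g' (c : Euc N))
    (hfg : ∀ᶠ y : frontier C in 𝓝 c, f y = g y) :
    HasSurfaceDerivAt f c (g' ∘L (tangentSpace C c).subtypeL) := by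
  have h1 := hg.isLittleO.comp_tendsto
    (continuous_subtype_val.tendsto c : Tendsto ((↑) : frontier C → Euc N) (𝓝 c) (𝓝 (c : Euc N)))
  have h2 := (g'.isBigO_comp _ _).trans_isLittleO (hC.isLittleO_sub_tangentProj c)
  refine (h1.add h2).congr' ?_ (by rfl)
  filter_upwards [hfg] with y hy
  simp only [Function.comp, hy, hfg.self_of_nhds, ContinuousLinearMap.comp_apply,
    Submodule.subtypeL_apply]
  rw [map_sub g' (_ - _)]
  abel

theorem HasSurfaceDerivAt.isBigO {V : Type*} [NormedAddCommGroup V] [NormedSpace ℝ V]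
    {f : frontier C → V} {c : frontier C} {L : tangentSpace C c →L[ℝ] V}
    (h : HasSurfaceDerivAt f c L) :
    (fun y => f y - f c) =O[𝓝 c] fun y : frontier C => (y : Euc N) - c := by
  have h1 := (L ∘L tangentProj C c).isBigO_comp (fun y : frontier C => (y : Euc N) - c) (𝓝 c)
  exact (Asymptotics.IsLittleO.isBigO h |>.add h1).congr_left fun y => by
    simp only [ContinuousLinearMap.comp_apply, sub_add_cancel]

theorem HasSurfaceDerivAt.continuousAt {V : Type*} [NormedAddCommGroup V] [NormedSpace ℝ V]
    {f : frontier C → V} {c : frontier C} {L : tangentSpace C c →L[ℝ] V}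
    (h : HasSurfaceDerivAt f c L) : ContinuousAt f c := by
  have h1 : Tendsto (fun y : frontier C => (y : Euc N) - c) (𝓝 c) (𝓝 0) := by
    have := (continuous_subtype_val.tendsto c).sub_const (c : Euc N)
    simpa using this
  have := h.isBigO.trans_tendsto h1
  exact tendsto_sub_nhds_zero_iff.1 this

theorem IsConvexCore.hasSurfaceDerivAt_outwardNormal (hC : IsConvexCore C) {c : frontier C}
    {G : Euc N → Euc N} (hG : IsNormalExtension C (c : Euc N) G) :
    HasSurfaceDerivAt (fun y : frontier C => outwardNormal C (y : Euc N)) c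
      (fderiv ℝ G c ∘L (tangentSpace C c).subtypeL) :=
  hC.hasSurfaceDerivAt (hG.contDiffAt.differentiableAt (by norm_num)).hasFDerivAt
    (IsNormalExtension.eventually_eq hG)

theorem IsConvexCore.coe_shapeOperator (hC : IsConvexCore C) {c : frontier C}
    {G : Euc N → Euc N} (hG : IsNormalExtension C (c : Euc N) G) (v : tangentSpace C c) :
    (shapeOperator C c v : Euc N) = -fderiv ℝ G c v := by
  have h : shapeOperator C c v = -(tangentProj C c (fderiv ℝ G c v)) := by
    unfold shapeOperator
    rw [(hC.hasSurfaceDerivAt_outwardNormal hG).surfaceDeriv_eq hC]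
    simp
  rw [h, Submodule.coe_neg, hC.coe_tangentProj, hG.eq_self,
    inner_fderiv_self_of_norm_eq_one (hG.contDiffAt.differentiableAt (by norm_num)) hG.norm_eq_one]
  simp

theorem IsConvexCore.shapeOperator_symm (hC : IsConvexCore C) (c : frontier C)
    (v w : tangentSpace C c) : ⟪shapeOperator C c v, w⟫ = ⟪v, shapeOperator C c w⟫ := by
  obtain ⟨G, hG⟩ := hC.exists_normalExtension c.2
  rw [Submodule.coe_inner, Submodule.coe_inner, hC.coe_shapeOperator hG, hC.coe_shapeOperator hG,
    inner_neg_left, inner_neg_right]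
  have hv := inner_outwardNormal_coe c v
  have hw := inner_outwardNormal_coe c w
  rw [hG.eq_self] at hv hw
  rw [hG.symm.self_of_nhds v w hv hw]

/-- Monotonicity of `ν`, divided by `t²` along a curve with velocity `v`, gives `⟪Dν v, v⟫ ≥ 0` in
the limit. -/
theorem IsConvexCore.shapeOperator_nonpos (hC : IsConvexCore C) (c : frontier C)
    (v : tangentSpace C c) : ⟪shapeOperator C c v, v⟫ ≤ 0 := by
  obtain ⟨G, hG⟩ := hC.exists_normalExtension c.2
  obtain ⟨γ, h0, hγ⟩ := hC.exists_curve c v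
  have h1 := (hC.hasSurfaceDerivAt_outwardNormal hG).comp_curve h0 hγ
  rw [Submodule.coe_inner, hC.coe_shapeOperator hG, inner_neg_left, neg_nonpos]
  have h2 := hasDerivWithinAt_iff_tendsto_slope.1 h1
  have h3 := hasDerivWithinAt_iff_tendsto_slope.1 hγ
  rw [sdiff_singleton_eq_self self_notMem_Ioi] at h2 h3
  refine ge_of_tendsto' (h2.inner h3) fun t => ?_
  simp only [slope_def_module, h0, sub_zero, real_inner_smul_left, real_inner_smul_right]
  rw [← mul_assoc]
  exact mul_nonneg (mul_self_nonneg _) (hC.monotone_outwardNormal c (γ t))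

end Surface

/-! ### The thickness function, the key identity and the fixed points -/

section Thickness

variable {N : ℕ} {C Ω : Set (Euc N)} {F : frontier C → frontier C}

/-- A frontier point strictly inside the outer cone would have points of `Ω` near it in that cone;
one strictly inside the inner cone would belong to the open set `Ω`. Either is impossible, so `∂Ω`
is tangent to `n^⊥` at `x`. -/
theorem IsInwardUnitNormal.isLittleO (hΩ : IsOpen Ω) {x n : Euc N}
    (hn : IsInwardUnitNormal Ω x n) :
    (fun z => ⟪n, z - x⟫) =o[𝓝[frontier Ω] x] fun z => z - x := by
  rw [Asymptotics.isLittleO_iff]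
  intro ε hε
  have h := hn.2.2 ε hε
  filter_upwards [nhdsWithin_le_nhds (eventually_eventually_nhds.2 h), self_mem_nhdsWithin]
    with z hz hzf
  rw [hΩ.frontier_eq] at hzf
  rw [Real.norm_eq_abs, abs_le]
  refine ⟨?_, ?_⟩
  · by_contra! hlt
    have hopen : ∀ᶠ y in 𝓝 z, ⟪n, y - x⟫ < -(ε * ‖y - x‖) := by
      have h1 : Continuous fun y => ⟪n, y - x⟫ :=
        continuous_const.inner (continuous_id.sub continuous_const)
      have h2 : Continuous fun y : Euc N => -(ε * ‖y - x‖) :=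
        (continuous_const.mul (continuous_id.sub continuous_const).norm).neg
      exact h1.continuousAt.eventually_lt h2.continuousAt hlt
    obtain ⟨y, hy, hy1, hy2⟩ := (mem_closure_iff_frequently.1 hzf.1).and_eventually
      (hz.and hopen) |>.exists
    exact hy1.2 hy2 hy
  · by_contra! hlt
    exact hzf.2 (hz.self_of_nhds.1 hlt)

theorem IsReturnMap.radialMap_mem (hF : IsReturnMap C Ω F) (c : frontier C) :
    radialMap C Ω c ∈ frontier Ω ∧ radialMap C Ω c ∉ C :=
  (hF c).1

theorem IsReturnMap.thickness_pos (hC : IsConvexCore C) (hF : IsReturnMap C Ω F)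
    (c : frontier C) : 0 < thickness C Ω c := by
  have h0 : 0 ≤ thickness C Ω c := Real.sSup_nonneg fun r hr => hr.1
  refine lt_of_le_of_ne h0 fun h => (hF.radialMap_mem c).2 ?_
  rw [radialMap, ← h, zero_smul, add_zero]
  exact hC.frontier_subset c.2

/-- The parameters at which the normal ray issued from `c` is in `Ω`. -/
def rayParams (C Ω : Set (Euc N)) (c : frontier C) : Set ℝ :=
  {r : ℝ | 0 ≤ r ∧ (c : Euc N) + r • outwardNormal C c ∈ Ω}

/-- The real supremum of an empty or an unbounded set defaults to `0`, so positivity of `d` excludes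
both cases, here and in the next lemma. -/
theorem IsReturnMap.rayParams_nonempty (hC : IsConvexCore C) (hF : IsReturnMap C Ω F)
    (c : frontier C) : (rayParams C Ω c).Nonempty := by
  by_contra h
  have h1 := hF.thickness_pos hC c
  have h2 : thickness C Ω c = sSup (rayParams C Ω c) := rfl
  rw [h2, not_nonempty_iff_eq_empty.1 h, Real.sSup_empty] at h1
  exact lt_irrefl _ h1

theorem IsReturnMap.rayParams_bddAbove (hC : IsConvexCore C) (hF : IsReturnMap C Ω F)
    (c : frontier C) : BddAbove (rayParams C Ω c) := by
  by_contra h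
  have h1 := hF.thickness_pos hC c
  have h2 : thickness C Ω c = sSup (rayParams C Ω c) := rfl
  rw [h2, Real.sSup_of_not_bddAbove h] at h1
  exact lt_irrefl _ h1

theorem ClassO.ordConnected_rayParams (hC : IsConvexCore C) (hΩ : ClassO C Ω) (c : frontier C) :
    (rayParams C Ω c).OrdConnected := by
  have hcont : Continuous fun x : Euc N => ⟪outwardNormal C (c : Euc N), x - c⟫ :=
    continuous_const.inner (continuous_id.sub continuous_const)
  have h := (hΩ.ray_connected c c.2).image _ hcont.continuousOn
  have hray : ∀ t : ℝ, ⟪outwardNormal C (c : Euc N),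
      (c : Euc N) + t • outwardNormal C (c : Euc N) - c⟫ = t := fun t => by
    rw [add_sub_cancel_left, real_inner_smul_right, real_inner_self_eq_norm_sq,
      hC.norm_outwardNormal c.2]
    ring
  refine Eq.subst (motive := Set.OrdConnected) (Eq.symm ?_) h.ordConnected
  ext r
  constructor
  · rintro ⟨h0, h1⟩
    exact ⟨_, ⟨⟨r, h0, rfl⟩, h1⟩, hray r⟩
  · rintro ⟨_, ⟨⟨t, ht, rfl⟩, h1⟩, rfl⟩
    simp only [hray]
    exact ⟨ht, h1⟩

theorem IsReturnMap.le_thickness (hC : IsConvexCore C) (hF : IsReturnMap C Ω F)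
    {c : frontier C} {r : ℝ} (h : r ∈ rayParams C Ω c) : r ≤ thickness C Ω c :=
  le_csSup (hF.rayParams_bddAbove hC c) h

theorem IsReturnMap.thickness_le (hC : IsConvexCore C) (hΩ : ClassO C Ω) (hF : IsReturnMap C Ω F)
    {c : frontier C} {r s : ℝ} (hr : r ∈ rayParams C Ω c) (hrs : r ≤ s)
    (hs : s ∉ rayParams C Ω c) : thickness C Ω c ≤ s := by
  refine csSup_le (hF.rayParams_nonempty hC c) fun t ht => ?_
  by_contra! hst
  exact hs ((hΩ.ordConnected_rayParams hC c).out hr ht ⟨hrs, hst.le⟩)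

/-- Were `⟪n, ν⟫` positive, the ray points just before `Φ(c)` would be outside `Ω`, yet `d(c)` is a
supremum of parameters in `Ω`. -/
theorem IsReturnMap.inner_inwardNormal_nonpos (hC : IsConvexCore C) (hΩ : ClassO C Ω)
    (hF : IsReturnMap C Ω F) {c : frontier C} {n : Euc N}
    (hn : IsInwardUnitNormal Ω (radialMap C Ω c) n) :
    ⟪n, outwardNormal C (c : Euc N)⟫ ≤ 0 := by
  by_contra! hpos
  set ν := outwardNormal C (c : Euc N)
  have hν : ‖ν‖ = 1 := hC.norm_outwardNormal c.2
  have h1 : Tendsto (fun r : ℝ => (c : Euc N) + r • ν) (𝓝 (thickness C Ω c))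
      (𝓝 (radialMap C Ω c)) :=
    (continuous_const.add (continuous_id.smul continuous_const)).tendsto (thickness C Ω c)
  have h2 := h1.eventually (hn.2.2 (⟪n, ν⟫ / 2) (by positivity))
  obtain ⟨δ, hδ, hball⟩ := Metric.eventually_nhds_iff.1 h2
  obtain ⟨r, hr, hlt⟩ := exists_lt_of_lt_csSup (hF.rayParams_nonempty hC c)
    (show thickness C Ω c - δ < sSup (rayParams C Ω c) by
      change thickness C Ω c - δ < thickness C Ω c; linarith)
  have hle : r ≤ thickness C Ω c := hF.le_thickness hC hr
  have hne : r < thickness C Ω c := by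
    refine lt_of_le_of_ne hle fun h => ?_
    have hf := (hF.radialMap_mem c).1
    rw [hΩ.isOpen.frontier_eq] at hf
    refine hf.2 ?_
    rw [radialMap, ← h]
    exact hr.2
  have hd : dist r (thickness C Ω c) < δ := by
    rw [Real.dist_eq, abs_of_neg (by linarith)]; linarith
  refine (hball hd).2 ?_ hr.2
  have hdiff : (c : Euc N) + r • ν - radialMap C Ω c = (r - thickness C Ω c) • ν := by
    rw [radialMap]; module
  rw [hdiff, real_inner_smul_right, norm_smul, hν, Real.norm_eq_abs, abs_of_neg (by linarith)]
  nlinarith [mul_pos hpos (sub_pos.2 hne)]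

theorem IsConvexCore.exists_hasSurfaceDerivAt_outwardNormal (hC : IsConvexCore C)
    (c : frontier C) : HasSurfaceDerivAt (fun y : frontier C => outwardNormal C (y : Euc N)) c
      ((tangentSpace C c).subtypeL ∘L (-shapeOperator C c)) := by
  obtain ⟨G, hG⟩ := hC.exists_normalExtension c.2
  convert hC.hasSurfaceDerivAt_outwardNormal hG using 1
  ext1 v
  simp [hC.coe_shapeOperator hG]

/-- The inward normal at `Φ(c)` is orthogonal to the image of the differential of `Φ`. -/
theorem IsReturnMap.inner_inwardNormal_eq_zero (hC : IsConvexCore C) (hΩ : ClassO C Ω)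
    (hF : IsReturnMap C Ω F) {c : frontier C} {n : Euc N}
    (hn : IsInwardUnitNormal Ω (radialMap C Ω c) n) {L : tangentSpace C c →L[ℝ] ℝ}
    (hL : HasSurfaceDerivAt (thickness C Ω) c L) (v : tangentSpace C c) :
    ⟪n, (radialOperator C Ω c v : Euc N)⟫ + L v * ⟪n, outwardNormal C (c : Euc N)⟫ = 0 := by
  obtain ⟨γ, h0, hγ⟩ := hC.exists_curve c v
  have h1 := (hC.exists_hasSurfaceDerivAt_outwardNormal c).comp_curve h0 hγ
  have h2 := hL.comp_curve h0 hγ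
  have h3 : HasDerivWithinAt (fun t => radialMap C Ω (γ t)) _ (Ioi 0) 0 := hγ.add (h2.smul h1)
  have h4 : HasDerivWithinAt (fun t => ⟪n, radialMap C Ω (γ t) - radialMap C Ω c⟫) _ (Ioi 0) 0 :=
    (hasDerivWithinAt_const (0 : ℝ) (Ioi 0) n).inner ℝ (h3.sub_const (radialMap C Ω c))
  -- The curve `Φ(γ t)` stays in `∂Ω`, which is tangent to `n^⊥`, so its normal component has zero
  -- derivative.
  have h5 : HasDerivWithinAt (fun t => ⟪n, radialMap C Ω (γ t) - radialMap C Ω c⟫) 0 (Ioi 0) 0 := by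
    rw [hasDerivWithinAt_iff_isLittleO]
    have hO : (fun t => radialMap C Ω (γ t) - radialMap C Ω c) =O[𝓝[>] 0] fun t : ℝ => t - 0 := by
      have := h3.hasFDerivWithinAt.isBigO_sub
      simpa [h0] using this
    have htend : Tendsto (fun t => radialMap C Ω (γ t)) (𝓝[>] 0)
        (𝓝[frontier Ω] (radialMap C Ω c)) := by
      refine tendsto_nhdsWithin_iff.2 ⟨?_, Eventually.of_forall fun t => (hF.radialMap_mem _).1⟩
      have := h3.continuousWithinAt.tendsto
      rwa [h0] at this
    refine (((hn.isLittleO hΩ.isOpen).comp_tendsto htend).trans_isBigO hO).congr_left fun t => ?_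
    simp [h0]
  have h6 := (uniqueDiffWithinAt_Ioi (0 : ℝ)).eq_deriv _ h4 h5
  simp only [h0, inner_add_right, inner_zero_left, add_zero, real_inner_smul_right,
    ContinuousLinearMap.comp_apply, Submodule.subtypeL_apply, neg_apply, Submodule.coe_neg,
    inner_neg_right] at h6
  have h7 : (radialOperator C Ω c v : Euc N)
      = (v : Euc N) - thickness C Ω c • (shapeOperator C c v : Euc N) := by
    simp [radialOperator]
  rw [h7, inner_sub_right, real_inner_smul_right]
  linarith

/-- This is `B ≥ I`, the quantitative form of invertibility: the term `-d ⟪S v, v⟫` is nonnegative.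
-/
theorem IsReturnMap.norm_sq_le_inner_radialOperator (hC : IsConvexCore C)
    (hF : IsReturnMap C Ω F) (c : frontier C) (v : tangentSpace C c) :
    ‖v‖ ^ 2 ≤ ⟪radialOperator C Ω c v, v⟫ := by
  have h1 := hF.thickness_pos hC c
  have h2 := hC.shapeOperator_nonpos c v
  have h3 : radialOperator C Ω c v = v - thickness C Ω c • shapeOperator C c v := by
    simp [radialOperator]
  rw [h3, inner_sub_left, real_inner_smul_left, real_inner_self_eq_norm_sq]
  nlinarith

theorem IsConvexCore.radialOperator_symm (hC : IsConvexCore C) (Ω : Set (Euc N)) (c : frontier C)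
    (v w : tangentSpace C c) : ⟪radialOperator C Ω c v, w⟫ = ⟪v, radialOperator C Ω c w⟫ := by
  simp only [radialOperator, sub_apply, one_apply_eq_self, smul_apply,
    inner_sub_left, inner_sub_right, real_inner_smul_left, real_inner_smul_right,
    hC.shapeOperator_symm]

theorem IsReturnMap.injective_radialOperator (hC : IsConvexCore C) (hF : IsReturnMap C Ω F)
    (c : frontier C) : Function.Injective (radialOperator C Ω c) := by
  rw [injective_iff_map_eq_zero]
  intro v hv
  have := hF.norm_sq_le_inner_radialOperator hC c v
  rw [hv, inner_zero_left] at this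
  exact norm_eq_zero.1 (pow_eq_zero_iff two_ne_zero |>.1 (le_antisymm this (sq_nonneg _)))

theorem IsReturnMap.isUnit_radialOperator (hC : IsConvexCore C) (hF : IsReturnMap C Ω F)
    (c : frontier C) : IsUnit (radialOperator C Ω c) := by
  have hinj := hF.injective_radialOperator hC c
  let e := LinearEquiv.ofInjectiveEndo (radialOperator C Ω c).toLinearMap hinj
  have he : (e.toContinuousLinearEquiv : tangentSpace C c →L[ℝ] tangentSpace C c)
      = radialOperator C Ω c := by
    ext1 v
    rfl
  rw [← he]
  exact ⟨(ContinuousLinearEquiv.unitsEquiv ℝ _).symm e.toContinuousLinearEquiv, rfl⟩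

theorem IsReturnMap.radialOperator_inverse (hC : IsConvexCore C) (hF : IsReturnMap C Ω F)
    (c : frontier C) (v : tangentSpace C c) :
    radialOperator C Ω c (Ring.inverse (radialOperator C Ω c) v) = v := by
  have := Ring.mul_inverse_cancel _ (hF.isUnit_radialOperator hC c)
  exact congrArg (fun L : tangentSpace C c →L[ℝ] tangentSpace C c => L v) this

theorem IsReturnMap.inverse_radialOperator (hC : IsConvexCore C) (hF : IsReturnMap C Ω F)
    (c : frontier C) (v : tangentSpace C c) :
    Ring.inverse (radialOperator C Ω c) (radialOperator C Ω c v) = v := by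
  have := Ring.inverse_mul_cancel _ (hF.isUnit_radialOperator hC c)
  exact congrArg (fun L : tangentSpace C c →L[ℝ] tangentSpace C c => L v) this

/-- On the ray from a nearby `y`, the parameter `d(c) - δ` is shown to lie in `Ω` and `d(c) + δ`
outside, with `δ = η |y - c|`. As rays meet `Ω` in intervals, `|d(y) - d(c)| ≤ δ`. -/
theorem IsReturnMap.hasSurfaceDerivAt_zero_of_normal (hC : IsConvexCore C) (hΩ : ClassO C Ω)
    (hF : IsReturnMap C Ω F) {c : frontier C}
    (hn : IsInwardUnitNormal Ω (radialMap C Ω c) (-outwardNormal C (c : Euc N))) :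
    HasSurfaceDerivAt (thickness C Ω) c 0 := by
  have hd := hF.thickness_pos hC c
  set d := thickness C Ω c with hd_def
  set ν : frontier C → Euc N := fun y => outwardNormal C (y : Euc N) with hν_def
  have hν : ∀ y, ‖ν y‖ = 1 := fun y => hC.norm_outwardNormal y.2
  have hνd := hC.exists_hasSurfaceDerivAt_outwardNormal c
  have hνc : Tendsto ν (𝓝 c) (𝓝 (ν c)) := hνd.continuousAt
  obtain ⟨K, hKpos, hK⟩ := hνd.isBigO.exists_pos
  have hK' := hK.bound
  unfold HasSurfaceDerivAt
  rw [Asymptotics.isLittleO_iff]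
  intro η' hη'
  obtain ⟨η, hη, hηη', hη1⟩ : ∃ η > 0, η ≤ η' ∧ η ≤ 1 :=
    ⟨min η' 1, by positivity, min_le_left _ _, min_le_right _ _⟩
  -- `M ‖u‖` bounds the distance from both test points to `Φ(c)`: `d K` accounts for the turning of
  -- `ν`, and `2` for `u` and the shift `δ ≤ ‖u‖`.
  set M := 2 + d * K with hM
  have hMpos : 0 < M := by positivity
  have hev := hn.2.2 (η / (4 * M)) (by positivity)
  have hsub : Tendsto (fun y : frontier C => (y : Euc N) - c) (𝓝 c) (𝓝 0) := by
    have := (continuous_subtype_val.tendsto c).sub_const (c : Euc N)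
    simpa using this
  have hpt : ∀ σ : ℝ, Tendsto (fun y : frontier C =>
      (y : Euc N) + (d + σ * (η * ‖(y : Euc N) - c‖)) • ν y) (𝓝 c) (𝓝 (radialMap C Ω c)) := by
    intro σ
    have := (continuous_subtype_val.tendsto c).add
      ((((hsub.norm.const_mul η).const_mul σ).const_add d).smul hνc)
    simpa [radialMap] using this
  have h1 := (hC.isLittleO_inner_outwardNormal c).def (c := η / 8) (by positivity)
  have hsmall : ∀ᶠ y in 𝓝 c, ‖ν y - ν c‖ < min 1 (η / (8 * (d * K + 1))) := by
    have := (hνc.sub_const (ν c)).norm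
    simp only [sub_self, norm_zero] at this
    exact this.eventually (gt_mem_nhds (by positivity))
  have hdsmall : ∀ᶠ y : frontier C in 𝓝 c, η * ‖(y : Euc N) - c‖ < d := by
    have := hsub.norm.const_mul η
    simp only [norm_zero, mul_zero] at this
    exact this.eventually (gt_mem_nhds hd)
  filter_upwards [h1, hsmall, hdsmall, hK', (hpt 1).eventually hev, (hpt (-1)).eventually hev]
    with y hy1 hy2 hy3 hy4 hyp hym
  simp only [zero_apply, sub_zero]
  set u := (y : Euc N) - c with hu
  set δ := η * ‖u‖ with hδ
  rcases eq_or_ne u 0 with hu0 | hu0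
  · have : y = c := Subtype.ext (sub_eq_zero.1 hu0)
    rw [this, ← hd_def, sub_self, norm_zero]
    positivity
  have hupos : 0 < ‖u‖ := norm_pos_iff.2 hu0
  have hδpos : 0 < δ := by positivity
  have hδu : δ ≤ ‖u‖ := by nlinarith
  have hdiff : ∀ σ : ℝ, (y : Euc N) + (d + σ * δ) • ν y - radialMap C Ω c
      = u + d • (ν y - ν c) + (σ * δ) • ν y := by
    intro σ
    rw [radialMap, hu]
    module
  have hnorm : ∀ σ : ℝ, |σ| = 1 → ‖u + d • (ν y - ν c) + (σ * δ) • ν y‖ ≤ M * ‖u‖ := by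
    intro σ hσ
    refine (norm_add_le _ _).trans ?_
    rw [norm_smul, hν, Real.norm_eq_abs, abs_mul, hσ, abs_of_pos hδpos]
    have := norm_add_le u (d • (ν y - ν c))
    rw [norm_smul, Real.norm_of_nonneg hd.le] at this
    have h3 : d * ‖ν y - ν c‖ ≤ d * (K * ‖u‖) := by gcongr
    rw [hM]
    linarith
  -- Turning a unit vector costs only second order in its own direction, so `d (ν y - ν c)` has a
  -- negligible component along `ν c`. The shift contributes at least `δ / 2`, which outweighs the
  -- errors `δ / 8` and `δ / 16` and the cone margin `δ / 4`.
  have hsq : ⟪ν c, ν y⟫ = 1 - ‖ν y - ν c‖ ^ 2 / 2 := by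
    rw [norm_sub_sq_real, hν, hν, real_inner_comm (ν y) (ν c)]
    ring
  have hsq' : d * ‖ν y - ν c‖ ^ 2 ≤ η / 8 * ‖u‖ := by
    have h2 : ‖ν y - ν c‖ ≤ η / (8 * (d * K + 1)) := (hy2.trans_le (min_le_right _ _)).le
    calc d * ‖ν y - ν c‖ ^ 2 = d * ‖ν y - ν c‖ * ‖ν y - ν c‖ := by ring
      _ ≤ d * (K * ‖u‖) * (η / (8 * (d * K + 1))) := by gcongr
      _ = (d * K / (d * K + 1)) * (η / 8 * ‖u‖) := by field_simp
      _ ≤ 1 * (η / 8 * ‖u‖) := by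
        gcongr
        rw [div_le_one (by positivity)]
        linarith
      _ = _ := one_mul _
  have hcos : 1 / 2 ≤ ⟪ν c, ν y⟫ := by
    have h2 : ‖ν y - ν c‖ ≤ 1 := (hy2.trans_le (min_le_left _ _)).le
    rw [hsq]
    nlinarith [norm_nonneg (ν y - ν c)]
  have hinner : ∀ σ : ℝ, ⟪ν c, u + d • (ν y - ν c) + (σ * δ) • ν y⟫
      = ⟪ν c, u⟫ - d * ‖ν y - ν c‖ ^ 2 / 2 + σ * (δ * ⟪ν c, ν y⟫) := by
    intro σ
    rw [inner_add_right, inner_add_right, real_inner_smul_right, real_inner_smul_right,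
      inner_sub_right (ν c) (ν y), real_inner_self_eq_norm_sq, hν, hsq]
    ring
  rw [Real.norm_eq_abs] at hy1
  have hy1' := abs_le.1 hy1
  have hsm : ∀ σ : ℝ, |σ| = 1 →
      η / (4 * M) * ‖u + d • (ν y - ν c) + (σ * δ) • ν y‖ ≤ δ / 4 := by
    intro σ hσ
    calc η / (4 * M) * ‖u + d • (ν y - ν c) + (σ * δ) • ν y‖
        ≤ η / (4 * M) * (M * ‖u‖) := by gcongr; exact hnorm σ hσ
      _ = δ / 4 := by rw [hδ]; field_simp
  have hδcos : δ / 2 ≤ δ * ⟪ν c, ν y⟫ := by nlinarith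
  have hnn : 0 ≤ d * ‖ν y - ν c‖ ^ 2 := by positivity
  have hin : (y : Euc N) + (d + -1 * δ) • ν y ∈ Ω := by
    refine hym.1 ?_
    rw [hdiff, inner_neg_left, hinner]
    have := hsm (-1) (by simp)
    linarith
  have hout : (y : Euc N) + (d + 1 * δ) • ν y ∉ Ω := by
    refine hyp.2 ?_
    rw [hdiff, inner_neg_left, hinner]
    have := hsm 1 (by simp)
    linarith
  have hr1 : d + -1 * δ ∈ rayParams C Ω y := ⟨by linarith, hin⟩
  have hr2 : d + 1 * δ ∉ rayParams C Ω y := fun h => hout h.2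
  have h8 := hF.le_thickness hC hr1
  have h9 := hF.thickness_le hC hΩ hr1 (by linarith) hr2
  rw [Real.norm_eq_abs, abs_le]
  have h10 : δ ≤ η' * ‖u‖ := by rw [hδ]; gcongr
  constructor <;> linarith

theorem mem_Crit_iff (hC : IsConvexCore C) {f : frontier C → ℝ} {c : frontier C} :
    c ∈ Crit f ↔ HasSurfaceDerivAt f c 0 := by
  constructor
  · rintro ⟨⟨L, hL⟩, h⟩
    rw [surfaceGrad, hL.surfaceDeriv_eq hC, LinearIsometryEquiv.map_eq_zero_iff] at h
    rwa [h] at hL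
  · intro h
    refine ⟨⟨0, h⟩, ?_⟩
    rw [surfaceGrad, h.surfaceDeriv_eq hC, map_zero]

theorem eq_smul_of_forall_inner_tangentSpace (hC : IsConvexCore C) {c : frontier C} {n : Euc N}
    (h : ∀ v : tangentSpace C c, ⟪n, (v : Euc N)⟫ = 0) :
    n = ⟪outwardNormal C (c : Euc N), n⟫ • outwardNormal C (c : Euc N) := by
  have h1 := h (tangentProj C c n)
  have h2 := inner_tangentProj c n (tangentProj C c n)
  rw [h1, real_inner_self_eq_norm_sq] at h2
  have h3 : tangentProj C c n = 0 := norm_eq_zero.1 (pow_eq_zero_iff two_ne_zero |>.1 h2)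
  have h4 := hC.coe_tangentProj c n
  rw [h3, Submodule.coe_zero] at h4
  exact sub_eq_zero.1 h4.symm

/-- With `Dd = 0`, `n` is orthogonal to the range of `B`, which is the whole tangent space. Hence `n
= ±ν`, and the sign of `⟪n, ν⟫` decides. -/
theorem IsReturnMap.normal_eq_neg (hC : IsConvexCore C) (hΩ : ClassO C Ω)
    (hF : IsReturnMap C Ω F) {c : frontier C} {n : Euc N}
    (hn : IsInwardUnitNormal Ω (radialMap C Ω c) n)
    (h : HasSurfaceDerivAt (thickness C Ω) c 0) : n = -outwardNormal C (c : Euc N) := by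
  have h1 : ∀ v : tangentSpace C c, ⟪n, (v : Euc N)⟫ = 0 := by
    intro v
    have := hF.inner_inwardNormal_eq_zero hC hΩ hn h (Ring.inverse (radialOperator C Ω c) v)
    rwa [hF.radialOperator_inverse hC, zero_apply, zero_mul, add_zero] at this
  have h2 := eq_smul_of_forall_inner_tangentSpace hC h1
  have h3 := hF.inner_inwardNormal_nonpos hC hΩ hn
  have h4 : |⟪outwardNormal C (c : Euc N), n⟫| = 1 := by
    have := hn.2.1
    rw [h2, norm_smul, hC.norm_outwardNormal c.2, mul_one, Real.norm_eq_abs] at this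
    exact this
  rw [real_inner_comm] at h3
  rw [abs_of_nonpos h3] at h4
  rw [h2, show ⟪outwardNormal C (c : Euc N), n⟫ = -1 by linarith]
  simp

theorem IsReturnMap.fixedPoints_eq (hC : IsConvexCore C) (hΩ : ClassO C Ω)
    (hF : IsReturnMap C Ω F) : Function.fixedPoints F = Crit (thickness C Ω) := by
  ext c
  rw [mem_Crit_iff hC, Function.mem_fixedPoints, Function.IsFixedPt]
  have hd := hF.thickness_pos hC c
  have hν := hC.norm_outwardNormal c.2
  obtain ⟨-, n, t, hn, ht, hFc⟩ := hF c
  constructor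
  · intro hfix
    rw [hfix] at hFc
    refine hF.hasSurfaceDerivAt_zero_of_normal hC hΩ ?_
    -- From `c = Φ(c) + t n` one gets `t n = -d ν`; comparing norms gives `t = d`, and `d > 0` can
    -- be cancelled.
    have h1 : t • n = -(thickness C Ω c • outwardNormal C (c : Euc N)) := by
      rw [radialMap] at hFc
      have := sub_eq_zero.2 hFc
      rw [← sub_eq_zero, ← neg_eq_zero, ← this]
      abel
    have h2 : t = thickness C Ω c := by
      have := congrArg norm h1
      rwa [norm_neg, norm_smul, norm_smul, hn.2.1, hν, mul_one, mul_one,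
        Real.norm_of_nonneg ht.1.1, Real.norm_of_nonneg hd.le] at this
    rw [h2, ← smul_neg] at h1
    rwa [smul_right_injective _ hd.ne' h1] at hn
  · intro h
    have hnν := hF.normal_eq_neg hC hΩ hn h
    subst hnν
    -- The half-line runs back along `ν` and reaches `c` at parameter `d`; the supporting hyperplane
    -- at `c` excludes an earlier hit.
    have h1 : t ≤ thickness C Ω c := by
      refine ht.2 ⟨hd.le, ?_⟩
      have : radialMap C Ω c + thickness C Ω c • -outwardNormal C (c : Euc N) = c := by
        rw [radialMap]; module
      rw [this]
      exact hC.frontier_subset c.2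
    have h2 : thickness C Ω c ≤ t := by
      have := hC.inner_outwardNormal_le c.2 ht.1.2
      rw [show radialMap C Ω c + t • -outwardNormal C (c : Euc N) - c
        = (thickness C Ω c - t) • outwardNormal C (c : Euc N) by rw [radialMap]; module,
        real_inner_smul_right, real_inner_self_eq_norm_sq, hν] at this
      linarith
    refine Subtype.ext ?_
    rw [hFc, le_antisymm h1 h2, radialMap]
    module

end Thickness

/-! ### The tilt and the differential of the return map at a fixed point -/

section Gradient

variable {N : ℕ} {C Ω : Set (Euc N)} {F : frontier C → frontier C}

theorem IsNormalExtension.eventually {c : Euc N} {G : Euc N → Euc N}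
    (hG : IsNormalExtension C c G) : ∀ᶠ y in 𝓝 c, IsNormalExtension C y G := by
  filter_upwards [hG.contDiffAt.eventually (by simp),
    eventually_eventually_nhds.2 hG.eq_outwardNormal,
    eventually_eventually_nhds.2 hG.norm_eq_one, eventually_eventually_nhds.2 hG.symm]
    with y h1 h2 h3 h4 using ⟨h1, h2, h3, h4⟩

theorem inner_surfaceGrad (f : frontier C → ℝ) (c : frontier C) (v : tangentSpace C c) :
    ⟪surfaceGrad f c, v⟫ = surfaceDeriv f c v :=
  InnerProductSpace.toDual_symm_apply

theorem surfaceGrad_eq (hC : IsConvexCore C) {f : frontier C → ℝ} {c : frontier C}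
    {g : Euc N → ℝ} (hg : DifferentiableAt ℝ g c) (hfg : ∀ᶠ y : frontier C in 𝓝 c, f y = g y) :
    surfaceGrad f c = tangentProj C c (gradient g c) := by
  refine ext_inner_right ℝ fun v => ?_
  rw [inner_surfaceGrad, inner_tangentProj,
    (hC.hasSurfaceDerivAt hg.hasFDerivAt hfg).surfaceDeriv_eq hC, inner_gradient_left]
  rfl

/-- Ambient extension of the surface gradient of the restriction of `g`. -/
noncomputable def gradExtension (G : Euc N → Euc N) (g : Euc N → ℝ) (y : Euc N) : Euc N :=
  gradient g y - ⟪G y, gradient g y⟫ • G y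

theorem contDiffAt_gradExtension {G : Euc N → Euc N} {g : Euc N → ℝ} {c : Euc N}
    (hG : ContDiffAt ℝ 1 G c) (hg : ContDiffAt ℝ 2 g c) :
    ContDiffAt ℝ 1 (gradExtension G g) c :=
  (contDiffAt_gradient hg).sub ((hG.inner ℝ (contDiffAt_gradient hg)).smul hG)

theorem eventually_surfaceGrad_eq (hC : IsConvexCore C) {f : frontier C → ℝ} {c : frontier C}
    {G : Euc N → Euc N} (hG : IsNormalExtension C (c : Euc N) G) {g : Euc N → ℝ}
    (hg : ContDiffAt ℝ 1 g c) (hfg : ∀ᶠ y : frontier C in 𝓝 c, f y = g y) :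
    ∀ᶠ y : frontier C in 𝓝 c, (surfaceGrad f y : Euc N) = gradExtension G g y := by
  have hval : Tendsto ((↑) : frontier C → Euc N) (𝓝 c) (𝓝 (c : Euc N)) :=
    continuous_subtype_val.tendsto c
  filter_upwards [eventually_eventually_nhds.2 hfg,
    hval.eventually (eventually_differentiableAt_of_contDiffAt hg),
    IsNormalExtension.eventually_eq hG] with y h1 h2 h3
  rw [surfaceGrad_eq hC h2 h1, hC.coe_tangentProj, h3]
  rfl

theorem hasSurfaceDerivAt_surfaceGrad (hC : IsConvexCore C) {f : frontier C → ℝ} {c : frontier C}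
    {G : Euc N → Euc N} (hG : IsNormalExtension C (c : Euc N) G) {g : Euc N → ℝ}
    (hg : ContDiffAt ℝ 2 g c) (hfg : ∀ᶠ y : frontier C in 𝓝 c, f y = g y) :
    HasSurfaceDerivAt (fun y : frontier C => (surfaceGrad f y : Euc N)) c
      (fderiv ℝ (gradExtension G g) c ∘L (tangentSpace C c).subtypeL) :=
  hC.hasSurfaceDerivAt
    ((contDiffAt_gradExtension hG.contDiffAt hg).differentiableAt (by norm_num)).hasFDerivAt
    (eventually_surfaceGrad_eq hC hG (hg.of_le (by norm_num)) hfg)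

/-- The Hessian of a `C²` function is symmetric. -/
theorem surfaceHess_symm (hC : IsConvexCore C) {f : frontier C → ℝ}
    (hf : SurfaceContDiff 2 f) (c : frontier C) (v w : tangentSpace C c) :
    ⟪surfaceHess f c v, w⟫ = ⟪v, surfaceHess f c w⟫ := by
  obtain ⟨G, hG⟩ := hC.exists_normalExtension c.2
  obtain ⟨g, hg, hfg⟩ := hf c
  have hg : ContDiffAt ℝ 2 g c := hg
  -- The derivative of the coefficient `⟪G, ∇g⟫` multiplies `G c`, which is orthogonal to `w`; both
  -- remaining terms are symmetric.
  have key : ∀ v w : tangentSpace C c, ⟪surfaceHess f c v, w⟫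
      = ⟪fderiv ℝ (gradient g) c v, (w : Euc N)⟫
        - ⟪G c, gradient g c⟫ * ⟪fderiv ℝ G c v, (w : Euc N)⟫ := by
    intro v w
    have h1 : surfaceHess f c v = tangentProj C c (fderiv ℝ (gradExtension G g) c v) := by
      unfold surfaceHess
      rw [(hasSurfaceDerivAt_surfaceGrad hC hG hg hfg).surfaceDeriv_eq hC]
      rfl
    have hGd := (hG.contDiffAt.differentiableAt (by norm_num)).hasFDerivAt
    have hgd := ((contDiffAt_gradient hg).differentiableAt (by norm_num)).hasFDerivAt
    have h2 : HasFDerivAt (gradExtension G g) _ (c : Euc N) :=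
      hgd.sub ((hGd.inner ℝ hgd).smul hGd)
    have hw := inner_outwardNormal_coe c w
    rw [hG.eq_self] at hw
    rw [h1, inner_tangentProj, h2.fderiv]
    simp [inner_sub_left, inner_add_left, real_inner_smul_left, hw]
  rw [key, real_inner_comm _ v, key]
  have hv := inner_outwardNormal_coe c v
  have hw := inner_outwardNormal_coe c w
  rw [hG.eq_self] at hv hw
  rw [hG.symm.self_of_nhds v w hv hw, inner_fderiv_gradient_comm hg,
    real_inner_comm (v : Euc N), real_inner_comm (v : Euc N)]

/-- The tangential component of the (rescaled) inward normal at `Φ(c)`. -/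
noncomputable def tilt (C Ω : Set (Euc N)) (c : frontier C) : tangentSpace C c :=
  Ring.inverse (radialOperator C Ω c) (surfaceGrad (thickness C Ω) c)

theorem IsReturnMap.norm_tilt_le (hC : IsConvexCore C) (hF : IsReturnMap C Ω F) (c : frontier C) :
    ‖tilt C Ω c‖ ≤ ‖surfaceGrad (thickness C Ω) c‖ := by
  have h1 := hF.norm_sq_le_inner_radialOperator hC c (tilt C Ω c)
  have h2 : radialOperator C Ω c (tilt C Ω c) = surfaceGrad (thickness C Ω) c :=
    hF.radialOperator_inverse hC c _
  rw [h2] at h1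
  have h3 := h1.trans (real_inner_le_norm _ _)
  rcases eq_or_lt_of_le (norm_nonneg (tilt C Ω c)) with h0 | h0
  · rw [← h0]; exact norm_nonneg _
  · nlinarith

/-- The return map, in terms of the gradient of the thickness function. -/
theorem IsReturnMap.exists_eq_tilt (hC : IsConvexCore C) (hΩ : ClassO C Ω)
    (hF : IsReturnMap C Ω F) {c : frontier C} {L : tangentSpace C c →L[ℝ] ℝ}
    (hL : HasSurfaceDerivAt (thickness C Ω) c L) :
    ∃ s : ℝ, IsLeast {s : ℝ | 0 ≤ s ∧ radialMap C Ω c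
        + s • ((tilt C Ω c : Euc N) - outwardNormal C (c : Euc N)) ∈ C} s ∧
      (F c : Euc N) = radialMap C Ω c
        + s • ((tilt C Ω c : Euc N) - outwardNormal C (c : Euc N)) := by
  obtain ⟨-, n, t, hn, ht, hFc⟩ := hF c
  set ν := outwardNormal C (c : Euc N)
  set a := -⟪n, ν⟫ with ha
  have ha0 : 0 ≤ a := by linarith [hF.inner_inwardNormal_nonpos hC hΩ hn]
  -- The key identity, with the symmetric `B` moved onto the tangential part of `n`.
  have hB : radialOperator C Ω c (tangentProj C c n) = a • surfaceGrad (thickness C Ω) c := by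
    refine ext_inner_right ℝ fun v => ?_
    rw [hC.radialOperator_symm, inner_tangentProj, real_inner_smul_left, inner_surfaceGrad,
      hL.surfaceDeriv_eq hC]
    linarith [hF.inner_inwardNormal_eq_zero hC hΩ hn hL v]
  have hproj : tangentProj C c n = a • tilt C Ω c := by
    rw [tilt, ← map_smul, ← hB, hF.inverse_radialOperator hC]
  have hn' : n = a • ((tilt C Ω c : Euc N) - ν) := by
    have h1 := hC.coe_tangentProj c n
    rw [hproj, Submodule.coe_smul, real_inner_comm] at h1
    rw [smul_sub, h1, ha]
    module
  have hapos : 0 < a := by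
    refine lt_of_le_of_ne ha0 fun h => ?_
    have := hn.2.1
    rw [hn', ← h, zero_smul, norm_zero] at this
    exact zero_ne_one this
  refine ⟨t * a, ⟨⟨by have := ht.1.1; positivity, ?_⟩, fun s hs => ?_⟩, ?_⟩
  · rw [mul_smul, ← hn']; exact ht.1.2
  · rw [← le_div_iff₀ hapos]
    refine ht.2 ⟨div_nonneg hs.1 hapos.le, ?_⟩
    rw [hn', smul_smul, div_mul_cancel₀ _ hapos.ne']
    exact hs.2
  · rw [mul_smul, ← hn']; exact hFc

/-- In the parametrization by `w - ν` the height above the tangent hyperplane at `c` is exactly `d -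
s`, and points of `C` have height at most `0`. -/
theorem IsReturnMap.le_return_parameter (hC : IsConvexCore C) {c : frontier C} {s : ℝ}
    (hs : radialMap C Ω c + s • ((tilt C Ω c : Euc N) - outwardNormal C (c : Euc N)) ∈ C) :
    thickness C Ω c ≤ s := by
  have h1 := hC.inner_outwardNormal_le c.2 hs
  have h2 := inner_outwardNormal_coe c (tilt C Ω c)
  rw [show radialMap C Ω c + s • ((tilt C Ω c : Euc N) - outwardNormal C (c : Euc N)) - c
    = (thickness C Ω c - s) • outwardNormal C (c : Euc N) + s • (tilt C Ω c : Euc N) by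
      rw [radialMap]; module, inner_add_right, real_inner_smul_right, real_inner_smul_right, h2,
    real_inner_self_eq_norm_sq, hC.norm_outwardNormal c.2] at h1
  linarith

/-- The tilt is differentiable at the critical points of the thickness function. -/
theorem IsReturnMap.hasSurfaceDerivAt_tilt (hC : IsConvexCore C)
    (hF : IsReturnMap C Ω F) (hd : SurfaceContDiff 2 (thickness C Ω)) {p : frontier C}
    (hp : surfaceGrad (thickness C Ω) p = 0) :
    HasSurfaceDerivAt (fun y : frontier C => (tilt C Ω y : Euc N)) p
      ((tangentSpace C p).subtypeL ∘L Ring.inverse (radialOperator C Ω p) ∘L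
        surfaceHess (thickness C Ω) p) := by
  obtain ⟨G, hG⟩ := hC.exists_normalExtension p.2
  obtain ⟨g, hg, hfg⟩ := hd p
  have hg : ContDiffAt ℝ 2 g p := hg
  have hval : Tendsto ((↑) : frontier C → Euc N) (𝓝 p) (𝓝 (p : Euc N)) :=
    continuous_subtype_val.tendsto p
  set f := thickness C Ω with hf
  have hgrad := hasSurfaceDerivAt_surfaceGrad hC hG hg hfg
  have hfd : HasSurfaceDerivAt f p _ :=
    hC.hasSurfaceDerivAt (hg.differentiableAt (by norm_num)).hasFDerivAt hfg
  set u : frontier C → Euc N := fun y => (y : Euc N) - p with hu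
  set w : frontier C → Euc N := fun y => (tilt C Ω y : Euc N) with hw
  have hwp : tilt C Ω p = 0 := by rw [tilt, ← hf, hp, map_zero]
  have hgradO : (fun y => (surfaceGrad f y : Euc N)) =O[𝓝 p] u := by
    refine hgrad.isBigO.congr_left fun y => ?_
    rw [hp, Submodule.coe_zero, sub_zero]
  have hwO : w =O[𝓝 p] u :=
    (Asymptotics.isBigO_of_le _ fun y => hF.norm_tilt_le hC y).trans hgradO
  -- the normal component of the tilt is negligible
  have hνw : (fun y => ⟪outwardNormal C (p : Euc N), w y⟫) =o[𝓝 p] u := by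
    have h1 : (fun y : frontier C => outwardNormal C (p : Euc N) - outwardNormal C (y : Euc N))
        =o[𝓝 p] fun _ => (1 : ℝ) := by
      rw [Asymptotics.isLittleO_one_iff]
      have := (hC.continuous_outwardNormal.tendsto p).const_sub (outwardNormal C (p : Euc N))
      simpa using this
    have h2 : (fun y : frontier C => ‖outwardNormal C (p : Euc N) - outwardNormal C (y : Euc N)‖
        * ‖w y‖) =o[𝓝 p] fun y => (1 : ℝ) * ‖u y‖ := h1.norm_left.mul_isBigO hwO.norm_norm
    simp only [one_mul] at h2
    refine (Asymptotics.isBigO_of_le _ fun y => ?_).trans_isLittleO h2.of_norm_right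
    rw [Real.norm_eq_abs, Real.norm_of_nonneg (by positivity)]
    have h3 : ⟪outwardNormal C (p : Euc N), w y⟫
        = ⟪outwardNormal C (p : Euc N) - outwardNormal C (y : Euc N), w y⟫ := by
      rw [inner_sub_left, inner_outwardNormal_coe y (tilt C Ω y), sub_zero]
    rw [h3]
    exact abs_real_inner_le_norm _ _
  have hwP : (fun y => w y - (tangentProj C p (w y) : Euc N)) =o[𝓝 p] u := by
    refine Asymptotics.IsLittleO.congr_left (f₁ := fun y =>
      ⟪outwardNormal C (p : Euc N), w y⟫ • outwardNormal C (p : Euc N)) ?_ ?_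
    · refine Asymptotics.IsLittleO.of_norm_left ?_
      simp only [norm_smul, hC.norm_outwardNormal p.2, mul_one]
      exact hνw.norm_left
    · intro y
      rw [hC.coe_tangentProj]
      abel
  -- the equation satisfied by the tilt, with frozen coefficients
  let B : Euc N →L[ℝ] Euc N := ContinuousLinearMap.id ℝ _ + f p • fderiv ℝ G p
  have hBw : (fun y => B (w y) - (surfaceGrad f y : Euc N)) =o[𝓝 p] u := by
    have hcoef : (fun y : frontier C => f p • fderiv ℝ G p - f y • fderiv ℝ G y)
        =o[𝓝 p] fun _ => (1 : ℝ) := by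
      rw [Asymptotics.isLittleO_one_iff]
      have h1 : Tendsto (fun y : frontier C => fderiv ℝ G y) (𝓝 p) (𝓝 (fderiv ℝ G p)) :=
        ((hG.contDiffAt.fderiv_right (m := 0) (by norm_num)).continuousAt.tendsto).comp hval
      have := ((hfd.continuousAt.tendsto).smul h1).const_sub (f p • fderiv ℝ G p)
      simpa using this
    have h2 : (fun y : frontier C => ‖f p • fderiv ℝ G p - f y • fderiv ℝ G y‖ * ‖w y‖)
        =o[𝓝 p] fun y => (1 : ℝ) * ‖u y‖ := hcoef.norm_left.mul_isBigO hwO.norm_norm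
    simp only [one_mul] at h2
    refine (Asymptotics.IsBigO.of_bound 1 ?_).trans_isLittleO h2.of_norm_right
    filter_upwards [hval.eventually hG.eventually] with y hy
    have h3 : radialOperator C Ω y (tilt C Ω y) = surfaceGrad f y :=
      hF.radialOperator_inverse hC y _
    have h4 : (surfaceGrad f y : Euc N) = w y + f y • fderiv ℝ G y (w y) := by
      rw [← h3]
      simp [radialOperator, hC.coe_shapeOperator hy, hw, hf]
    have h5 : B (w y) - (surfaceGrad f y : Euc N)
        = (f p • fderiv ℝ G p - f y • fderiv ℝ G y) (w y) := by
      rw [h4]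
      simp only [B, add_apply, ContinuousLinearMap.id_apply, smul_apply, sub_apply]
      abel
    rw [h5, one_mul, Real.norm_of_nonneg (by positivity)]
    exact ContinuousLinearMap.le_opNorm _ _
  have hBT : ∀ v : tangentSpace C p, tangentProj C p (B v) = radialOperator C Ω p v := by
    intro v
    have : B v = (radialOperator C Ω p v : Euc N) := by
      simp [B, radialOperator, hC.coe_shapeOperator hG, hf]
    rw [this, tangentProj_coe]
  have hmain : (fun y => radialOperator C Ω p (tangentProj C p (w y))
      - surfaceHess f p (tangentProj C p (u y))) =o[𝓝 p] u := by
    have h1 := ((tangentProj C p).isBigO_comp _ _).trans_isLittleO hBw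
    have h2 := ((tangentProj C p).isBigO_comp _ _).trans_isLittleO hgrad
    have h3 := ((tangentProj C p ∘L B).isBigO_comp _ _).trans_isLittleO hwP
    refine ((h1.add h2).sub h3).congr_left fun y => ?_
    have h4 : surfaceHess f p (tangentProj C p (u y)) = tangentProj C p
        ((fderiv ℝ (gradExtension G g) p ∘L (tangentSpace C p).subtypeL)
          (tangentProj C p (u y))) := by
      unfold surfaceHess
      rw [hgrad.surfaceDeriv_eq hC]
      rfl
    rw [h4, ← hBT]
    set q := (fderiv ℝ (gradExtension G g) p ∘L (tangentSpace C p).subtypeL)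
      (tangentProj C p (u y)) with hq
    set x := (tangentProj C p (w y) : Euc N)
    change tangentProj C p (B (w y) - (surfaceGrad f y : Euc N))
      + tangentProj C p ((surfaceGrad f y : Euc N) - (surfaceGrad f p : Euc N) - q)
      - tangentProj C p (B (w y - x)) = tangentProj C p (B x) - tangentProj C p q
    rw [hp, Submodule.coe_zero, sub_zero]
    simp only [map_sub]
    abel
  have hinv := ((Ring.inverse (radialOperator C Ω p)).isBigO_comp _ _).trans_isLittleO hmain
  have hinv' := ((tangentSpace C p).subtypeL.isBigO_comp _ _).trans_isLittleO hinv
  refine (hwP.add hinv').congr_left fun y => ?_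
  have hwp' : w p = 0 := by simp [hw, hwp]
  change _ = w y - w p - (Ring.inverse (radialOperator C Ω p)
    (surfaceHess f p (tangentProj C p (u y))) : tangentSpace C p)
  rw [hwp', sub_zero, map_sub (Ring.inverse (radialOperator C Ω p)),
    hF.inverse_radialOperator hC, Submodule.subtypeL_apply, Submodule.coe_sub]
  abel

/-- The return map is differentiable at its fixed points. -/
theorem IsReturnMap.hasSurfaceDerivAt (hC : IsConvexCore C) (hΩ : ClassO C Ω)
    (hF : IsReturnMap C Ω F) (hd : SurfaceContDiff 2 (thickness C Ω)) {p : frontier C}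
    (hp : F p = p) :
    HasSurfaceDerivAt (fun y : frontier C => (F y : Euc N)) p
      ((tangentSpace C p).subtypeL ∘L roundTripLinearization C Ω p) := by
  have hcrit : p ∈ Crit (thickness C Ω) := by
    rw [← hF.fixedPoints_eq hC hΩ]; exact hp
  have hgrad0 := hcrit.2
  have htilt := hF.hasSurfaceDerivAt_tilt hC hd hgrad0
  set f := thickness C Ω with hf
  set ν : frontier C → Euc N := fun y => outwardNormal C (y : Euc N) with hν_def
  have hν : ∀ y, ‖ν y‖ = 1 := fun y => hC.norm_outwardNormal y.2
  set u : frontier C → Euc N := fun y => (y : Euc N) - p with hu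
  set w : frontier C → Euc N := fun y => (tilt C Ω y : Euc N) with hw
  have hwp : w p = 0 := by
    have : tilt C Ω p = 0 := by rw [tilt, ← hf, hgrad0, map_zero]
    simp [hw, this]
  obtain ⟨g, hg, hfg⟩ := hd p
  have hg : ContDiffAt ℝ 2 g p := hg
  have hval : Tendsto ((↑) : frontier C → Euc N) (𝓝 p) (𝓝 (p : Euc N)) :=
    continuous_subtype_val.tendsto p
  have hu0 : Tendsto u (𝓝 p) (𝓝 0) := by
    have := hval.sub_const (p : Euc N)
    simpa using this
  have hfd : HasSurfaceDerivAt f p _ :=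
    hC.hasSurfaceDerivAt (hg.differentiableAt (by norm_num)).hasFDerivAt hfg
  have hdiff : ∀ᶠ y in 𝓝 p, ∃ L, HasSurfaceDerivAt f y L := by
    filter_upwards [eventually_eventually_nhds.2 hfg, hval.eventually
      (eventually_differentiableAt_of_contDiffAt (hg.of_le (by norm_num)))] with y h1 h2
    exact ⟨_, hC.hasSurfaceDerivAt h2.hasFDerivAt h1⟩
  have hνc : Tendsto ν (𝓝 p) (𝓝 (ν p)) := hC.continuous_outwardNormal.tendsto p
  have hwO : w =O[𝓝 p] u := by
    refine htilt.isBigO.congr_left fun y => ?_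
    change w y - w p = w y
    rw [hwp, sub_zero]
  have hw0 : Tendsto w (𝓝 p) (𝓝 0) := hwO.trans_tendsto hu0
  have hνw : (fun y => ⟪ν p, w y⟫) =o[𝓝 p] u := by
    have := ((innerSL ℝ (ν p)).isBigO_comp _ _).trans_isLittleO htilt
    refine this.congr_left fun y => ?_
    change ⟪ν p, w y - w p - _⟫ = _
    rw [hwp, sub_zero, inner_sub_right]
    erw [inner_outwardNormal_coe p]
    rw [sub_zero]
  -- the parameter of the first hitting point
  let s : frontier C → ℝ := fun y => ⟪-ν y, (F y : Euc N) - radialMap C Ω y⟫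
  have hs : ∀ᶠ y in 𝓝 p, IsLeast {s : ℝ | 0 ≤ s ∧ radialMap C Ω y + s • (w y - ν y) ∈ C} (s y) ∧
      (F y : Euc N) = radialMap C Ω y + s y • (w y - ν y) := by
    filter_upwards [hdiff] with y ⟨L, hL⟩
    obtain ⟨σ, h1, h2⟩ := hF.exists_eq_tilt hC hΩ hL
    have h3 : s y = σ := by
      simp only [s]
      rw [h2, add_sub_cancel_left, real_inner_smul_right, inner_sub_right, inner_neg_left,
        inner_neg_left, inner_outwardNormal_coe y (tilt C Ω y), real_inner_self_eq_norm_sq, hν]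
      ring
    rw [h3]
    exact ⟨h1, h2⟩
  -- The bound `d ≤ s` comes from the supporting hyperplane at `y`. For the upper bound, the point
  -- at parameter `d + ε ‖u‖` lies in `C` by the uniform interior condition: along `ν p` it has
  -- descended by at least `ε ‖u‖ / 2`, while `w`, almost orthogonal to `ν p`, restores at most `ε
  -- ‖u‖ / 4`.
  have hsd : (fun y => s y - f y) =o[𝓝 p] u := by
    rw [Asymptotics.isLittleO_iff]
    intro ε hε
    have hfp : 0 < f p := hF.thickness_pos hC p
    obtain ⟨K, hKpos, hK⟩ := hwO.exists_pos
    set D := 2 * f p with hD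
    have hDpos : 0 < D := by positivity
    set M := ε + D * K with hM
    have hMpos : 0 < M := by positivity
    have hDev : ∀ᶠ y in 𝓝 p, f y + ε * ‖u y‖ < D := by
      have h1 := (hfd.continuousAt.tendsto).add (hu0.norm.const_mul ε)
      rw [norm_zero, mul_zero, add_zero] at h1
      exact h1.eventually (gt_mem_nhds (by linarith))
    have hcos : ∀ᶠ y in 𝓝 p, 1 / 2 < ⟪ν p, ν y⟫ := by
      have h1 : Tendsto (fun y => ⟪ν p, ν y⟫) (𝓝 p) (𝓝 ⟪ν p, ν p⟫) := tendsto_const_nhds.inner hνc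
      rw [real_inner_self_eq_norm_sq, hν] at h1
      exact h1.eventually (lt_mem_nhds (by norm_num))
    have hmem := hC.eventually_mem p.2 (ε := ε / (4 * M)) (by positivity)
    have htend : Tendsto (fun y : frontier C => ((y : Euc N),
        radialMap C Ω y + (f y + ε * ‖u y‖) • (w y - ν y))) (𝓝 p) (𝓝 ((p : Euc N), (p : Euc N))) := by
      refine hval.prodMk_nhds ?_
      have h1 := (hfd.continuousAt.tendsto).add (hu0.norm.const_mul ε)
      have h2 := ((hval.add (hfd.continuousAt.tendsto.smul hνc))).add (h1.smul (hw0.sub hνc))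
      rw [norm_zero, mul_zero, add_zero, zero_sub, smul_neg, add_neg_cancel_right] at h2
      exact h2
    filter_upwards [hs, hDev, hcos, htend.eventually hmem, hK.bound,
      hνw.def (c := ε / (4 * D)) (by positivity)] with y h1 h2 h3 h4 h5 h6
    have h7 : f y ≤ s y := IsReturnMap.le_return_parameter hC h1.1.1.2
    have hfy : 0 < f y := hF.thickness_pos hC y
    have h8 : s y ≤ f y + ε * ‖u y‖ := by
      refine h1.1.2 ⟨by positivity, h4 y.2 ?_⟩
      have h9 : radialMap C Ω y + (f y + ε * ‖u y‖) • (w y - ν y) - y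
          = (f y + ε * ‖u y‖) • w y - (ε * ‖u y‖) • ν y := by
        rw [radialMap]; module
      change ⟪ν p, radialMap C Ω y + (f y + ε * ‖u y‖) • (w y - ν y) - y⟫
        ≤ -(ε / (4 * M) * ‖radialMap C Ω y + (f y + ε * ‖u y‖) • (w y - ν y) - y‖)
      rw [h9]
      have h10 : ‖(f y + ε * ‖u y‖) • w y - (ε * ‖u y‖) • ν y‖ ≤ M * ‖u y‖ := by
        refine (norm_sub_le _ _).trans ?_
        rw [norm_smul, norm_smul, hν, Real.norm_of_nonneg (by positivity),
          Real.norm_of_nonneg (by positivity)]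
        have : (f y + ε * ‖u y‖) * ‖w y‖ ≤ D * (K * ‖u y‖) := by gcongr
        rw [hM]; linarith
      have h11 : ε / (4 * M) * ‖(f y + ε * ‖u y‖) • w y - (ε * ‖u y‖) • ν y‖
          ≤ ε / 4 * ‖u y‖ := by
        calc _ ≤ ε / (4 * M) * (M * ‖u y‖) := by gcongr
          _ = ε / 4 * ‖u y‖ := by field_simp
      have h12 : (f y + ε * ‖u y‖) * ⟪ν p, w y⟫ ≤ ε / 4 * ‖u y‖ := by
        calc (f y + ε * ‖u y‖) * ⟪ν p, w y⟫ ≤ (f y + ε * ‖u y‖) * (ε / (4 * D) * ‖u y‖) := by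
              gcongr
              exact (le_abs_self _).trans h6
          _ ≤ D * (ε / (4 * D) * ‖u y‖) := by gcongr
          _ = ε / 4 * ‖u y‖ := by field_simp
      rw [inner_sub_right, real_inner_smul_right, real_inner_smul_right]
      have h13 : ε * ‖u y‖ * (1 / 2) ≤ ε * ‖u y‖ * ⟪ν p, ν y⟫ := by gcongr
      linarith
    rw [Real.norm_eq_abs, abs_of_nonneg (by linarith)]
    linarith
  have h1 := hC.isLittleO_sub_tangentProj p
  have h2 : (fun y => (f y - s y) • ν y) =o[𝓝 p] u := by
    refine Asymptotics.IsLittleO.of_norm_left ?_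
    simp only [norm_smul, hν, mul_one]
    exact (hsd.neg_left.congr_left fun y => by ring).norm_left
  have h3 : (fun y => (s y - f p) • w y) =o[𝓝 p] u := by
    have h4 : (fun y => s y - f p) =o[𝓝 p] fun _ => (1 : ℝ) := by
      rw [Asymptotics.isLittleO_one_iff]
      have := (hsd.trans_tendsto hu0).add (hfd.continuousAt.tendsto.sub_const (f p))
      simpa using this
    have := h4.smul_isBigO hwO
    simpa using this
  have h5 := htilt.const_smul_left (f p)
  refine (((h1.add h2).add h3).add h5).congr' ?_ (by rfl)
  filter_upwards [hs] with y hy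
  have h6 : roundTripLinearization C Ω p (tangentProj C p (u y)) = tangentProj C p (u y)
      + f p • Ring.inverse (radialOperator C Ω p) (surfaceHess f p (tangentProj C p (u y))) := by
    simp [roundTripLinearization, roundTripOperator, hf]
  rw [ContinuousLinearMap.comp_apply, h6, hy.2, hp, Pi.smul_apply, hwp]
  simp only [radialMap, Submodule.subtypeL_apply, Submodule.coe_add, Submodule.coe_smul,
    ContinuousLinearMap.comp_apply, sub_zero]
  simp only [hw, hν_def, hf, hu]
  module

end Gradient

/-! ### Endomorphisms with a basis of eigenvectors -/

section LinearAlgebra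

variable {V : Type*} [AddCommGroup V] [Module ℝ V]

/-- An endomorphism that is symmetric for some inner product has a basis of eigenvectors. -/
theorem exists_eigenbasis_of_core [FiniteDimensional ℝ V] (core : InnerProductSpace.Core ℝ V)
    (L : V →ₗ[ℝ] V) (h : ∀ x y, core.inner (L x) y = core.inner x (L y)) :
    ∃ (e : Module.Basis (Fin (Module.finrank ℝ V)) ℝ V) (μ : Fin (Module.finrank ℝ V) → ℝ),
      ∀ i, L (e i) = μ i • e i := by
  let : NormedAddCommGroup V := core.toNormedAddCommGroup
  let : InnerProductSpace ℝ V := InnerProductSpace.ofCore core.toCore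
  have hL : L.IsSymmetric := h
  refine ⟨(hL.eigenvectorBasis rfl).toBasis, hL.eigenvalues rfl, fun i => ?_⟩
  rw [OrthonormalBasis.coe_toBasis]
  exact hL.apply_eigenvectorBasis rfl i

variable {ι : Type*} {e : Module.Basis ι ℝ V} {L : Module.End ℝ V} {μ : ι → ℝ}

theorem repr_apply_of_eigenbasis (h : ∀ i, L (e i) = μ i • e i) (x : V) (i : ι) :
    e.repr (L x) i = μ i * e.repr x i := by
  have : e.coord i ∘ₗ L = μ i • e.coord i := by
    refine e.ext fun j => ?_
    rw [LinearMap.comp_apply, h, map_smul, LinearMap.smul_apply, Module.Basis.coord_apply,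
      Module.Basis.repr_self, smul_eq_mul, smul_eq_mul]
    rcases eq_or_ne j i with rfl | hji
    · rfl
    · rw [Finsupp.single_eq_of_ne hji.symm, mul_zero, mul_zero]
  exact LinearMap.congr_fun this x

theorem iSup_eigenspace_eq_top (h : ∀ i, L (e i) = μ i • e i) :
    (⨆ a : ℝ, L.eigenspace a) = ⊤ := by
  rw [eq_top_iff, ← e.span_eq, Submodule.span_le]
  rintro _ ⟨i, rfl⟩
  exact Submodule.mem_iSup_of_mem (μ i) (Module.End.mem_eigenspace_iff.2 (h i))

/-- An eigenspace for an eigenvalue other than `μ i` lies in the kernel of the `i`-th coordinate.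
This turns the dimension counts of `spectralType` into statements about the `μ i`. -/
theorem repr_eq_zero_of_mem_iSup_eigenspace (h : ∀ i, L (e i) = μ i • e i) {P : Set ℝ} {i : ι}
    (hi : μ i ∉ P) {x : V} (hx : x ∈ ⨆ a ∈ P, L.eigenspace a) : e.repr x i = 0 := by
  have hle : (⨆ a ∈ P, L.eigenspace a) ≤ LinearMap.ker (e.coord i) := by
    refine iSup₂_le fun a ha y hy => ?_
    rw [LinearMap.mem_ker, Module.Basis.coord_apply]
    have h1 := repr_apply_of_eigenbasis h y i
    rw [Module.End.mem_eigenspace_iff.1 hy, map_smul, Finsupp.smul_apply, smul_eq_mul] at h1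
    have h2 : a - μ i ≠ 0 := fun h0 => hi (by rwa [← sub_eq_zero.1 h0])
    exact (mul_eq_zero.1 (show (a - μ i) * e.repr y i = 0 by rw [sub_mul, h1, sub_self])
      ).resolve_left h2
  exact hle hx

theorem mem_of_finrank_iSup_eigenspace_eq [FiniteDimensional ℝ V]
    (h : ∀ i, L (e i) = μ i • e i) {P : Set ℝ}
    (hP : Module.finrank ℝ ↥(⨆ a ∈ P, L.eigenspace a) = Module.finrank ℝ V) (i : ι) :
    μ i ∈ P := by
  by_contra hi
  have htop := Submodule.eq_top_of_finrank_eq hP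
  have := repr_eq_zero_of_mem_iSup_eigenspace h hi (x := e i) (by rw [htop]; trivial)
  rw [Module.Basis.repr_self, Finsupp.single_eq_same] at this
  exact one_ne_zero this

theorem exists_mem_of_finrank_iSup_eigenspace_pos (h : ∀ i, L (e i) = μ i • e i) {P : Set ℝ}
    (hP : 0 < Module.finrank ℝ ↥(⨆ a ∈ P, L.eigenspace a)) : ∃ i, μ i ∈ P := by
  by_contra! hi
  have hbot : (⨆ a ∈ P, L.eigenspace a) = ⊥ := by
    rw [Submodule.eq_bot_iff]
    intro x hx
    refine e.ext_elem fun i => ?_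
    rw [repr_eq_zero_of_mem_iSup_eigenspace h (hi i) hx, map_zero, Finsupp.zero_apply]
  rw [hbot, finrank_bot] at hP
  exact lt_irrefl _ hP

end LinearAlgebra

/-! ### Local dynamics in diagonal coordinates -/

section Dynamics

/-- `z` is a system of coordinates at the fixed point `p` of `F` in which `F` has, to first order,
the diagonal form with entries `μ`. -/
structure IsDiagonalCoordinate {X : Type*} [MetricSpace X] {ι : Type*} [Fintype ι] (F : X → X)
    (p : X) (z : X → ι → ℝ) (μ : ι → ℝ) (K : ℝ) : Prop where
  pos : 0 < K
  fixed : F p = p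
  continuousAt : ContinuousAt F p
  dist_le : ∀ᶠ y in 𝓝 p, dist y p ≤ K * ‖z y‖
  norm_le : ∀ᶠ y in 𝓝 p, ‖z y‖ ≤ K * dist y p
  linear : ∀ ε > (0 : ℝ), ∀ᶠ y in 𝓝 p, ∀ i, |z (F y) i - μ i * z y i| ≤ ε * ‖z y‖

variable {X : Type*} [MetricSpace X] {ι : Type*} [Fintype ι] {F : X → X} {p : X} {z : X → ι → ℝ}
  {μ : ι → ℝ} {K : ℝ}

/-- Orbits that start in the expanding cone leave a fixed neighbourhood. -/
theorem IsDiagonalCoordinate.exists_nhds_leaving (h : IsDiagonalCoordinate F p z μ K) :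
    ∃ U ∈ 𝓝 p, ∀ c ∈ U, c ≠ p → (∃ i, 1 < |μ i| ∧ ∀ j, |z c j| ≤ |z c i|) →
      ∃ k : ℕ, F^[k] c ∉ U := by
  classical
  -- `m` is the least expanding modulus, or `2` when there is none. With linearization error `ε = (m
  -- - 1) / 3`, expanding coordinates grow by `r = m - ε`, which exceeds the factor `1 + ε`
  -- available to the others.
  obtain ⟨m, hm1, hm⟩ : ∃ m : ℝ, 1 < m ∧ ∀ i, 1 < |μ i| → m ≤ |μ i| := by
    by_cases hne : (Finset.univ.filter fun i => 1 < |μ i|).Nonempty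
    · obtain ⟨i, hi, hmin⟩ := Finset.exists_min_image _ (fun i => |μ i|) hne
      exact ⟨|μ i|, (Finset.mem_filter.1 hi).2, fun j hj =>
        hmin j (Finset.mem_filter.2 ⟨Finset.mem_univ _, hj⟩)⟩
    · exact ⟨2, one_lt_two, fun i hi =>
        absurd ⟨i, Finset.mem_filter.2 ⟨Finset.mem_univ _, hi⟩⟩ hne⟩
  obtain ⟨δ, hδ, hball⟩ := Metric.eventually_nhds_iff.1
    (h.dist_le.and (h.norm_le.and (h.linear ((m - 1) / 3) (by linarith))))
  refine ⟨Metric.ball p δ, Metric.ball_mem_nhds p hδ, fun c hc hcp hcone => ?_⟩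
  by_contra! hstay
  set r := m - (m - 1) / 3 with hr
  have hr1 : 1 < r := by linarith
  -- The cone where the sup norm is attained at an expanding coordinate is forward invariant while
  -- the orbit stays in the ball, and the norm grows geometrically there. The maximizing index may
  -- change from step to step.
  have key : ∀ k, (∃ i, 1 < |μ i| ∧ ∀ j, |z (F^[k] c) j| ≤ |z (F^[k] c) i|) ∧
      r ^ k * ‖z c‖ ≤ ‖z (F^[k] c)‖ := by
    intro k
    induction k with
    | zero => exact ⟨hcone, by simp⟩
    | succ k ih =>
      obtain ⟨⟨i, hi, hmax⟩, hgrow⟩ := ih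
      rw [Function.iterate_succ_apply']
      set y := F^[k] c with hy
      obtain ⟨-, -, hlin⟩ := hball (hstay k)
      have hnorm : ‖z y‖ = |z y i| :=
        le_antisymm ((pi_norm_le_iff_of_nonneg (abs_nonneg _)).2 hmax) (norm_le_pi_norm (z y) i)
      have hlow : r * ‖z y‖ ≤ |z (F y) i| := by
        have h1 := hlin i
        have h2 := abs_sub_abs_le_abs_sub (μ i * z y i) (z (F y) i)
        rw [abs_sub_comm, abs_mul, ← hnorm] at h2
        have h3 : m * ‖z y‖ ≤ |μ i| * ‖z y‖ := by gcongr; exact hm i hi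
        rw [hr]
        linarith
      have hup : ∀ j, |μ j| ≤ 1 → |z (F y) j| ≤ |z (F y) i| := by
        intro j hj
        have h1 := hlin j
        have h2 := abs_sub_abs_le_abs_sub (z (F y) j) (μ j * z y j)
        rw [abs_mul] at h2
        have h3 : |μ j| * |z y j| ≤ 1 * ‖z y‖ := by
          gcongr
          exact norm_le_pi_norm (z y) j
        have h4 : (1 + (m - 1) / 3) * ‖z y‖ ≤ r * ‖z y‖ := by gcongr; linarith
        linarith
      refine ⟨?_, ?_⟩
      · obtain ⟨i', hi', hmax'⟩ := Finset.exists_max_image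
          (Finset.univ.filter fun i => 1 < |μ i|) (fun i => |z (F y) i|)
          ⟨i, Finset.mem_filter.2 ⟨Finset.mem_univ _, hi⟩⟩
        refine ⟨i', (Finset.mem_filter.1 hi').2, fun j => ?_⟩
        by_cases hj : 1 < |μ j|
        · exact hmax' j (Finset.mem_filter.2 ⟨Finset.mem_univ _, hj⟩)
        · exact (hup j (not_lt.1 hj)).trans
            (hmax' i (Finset.mem_filter.2 ⟨Finset.mem_univ _, hi⟩))
      · calc r ^ (k + 1) * ‖z c‖ = r * (r ^ k * ‖z c‖) := by ring
          _ ≤ r * ‖z y‖ := by gcongr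
          _ ≤ |z (F y) i| := hlow
          _ ≤ _ := norm_le_pi_norm (z (F y)) i
  have hzc : 0 < ‖z c‖ := by
    have h1 := (hball hc).1
    have h2 := dist_pos.2 hcp
    exact pos_of_mul_pos_right (h2.trans_le h1) h.pos.le
  obtain ⟨k, hk⟩ := pow_unbounded_of_one_lt (K * δ / ‖z c‖) hr1
  rw [div_lt_iff₀ hzc] at hk
  have h1 := (hball (hstay k)).2.1
  have h2 : K * dist (F^[k] c) p ≤ K * δ := by
    have := h.pos
    gcongr
    exact (hstay k).le
  linarith [(key k).2]

theorem IsDiagonalCoordinate.isRepelling (h : IsDiagonalCoordinate F p z μ K)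
    (hμ : ∀ i, 1 < |μ i|) : IsRepelling F p := by
  obtain ⟨U, hU, hleave⟩ := h.exists_nhds_leaving
  -- The extra condition handles an empty index set: then `z = 0`, and the neighbourhood reduces to
  -- `p`.
  refine ⟨U ∩ {y | dist y p ≤ K * ‖z y‖}, inter_mem hU h.dist_le, fun c hc hcp => ?_⟩
  have hne : Nonempty ι := by
    by_contra hempty
    rw [not_nonempty_iff] at hempty
    have h1 : ‖z c‖ = 0 := by simp [Subsingleton.elim (z c) 0]
    have h2 := hc.2
    rw [mem_ofPred_eq, h1, mul_zero] at h2
    exact hcp (dist_le_zero.1 h2)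
  obtain ⟨i, hi⟩ := Finite.exists_max fun i => |z c i|
  obtain ⟨k, hk⟩ := hleave c hc.1 hcp ⟨i, hμ i, hi⟩
  exact ⟨k, fun hmem => hk hmem.1⟩

theorem IsDiagonalCoordinate.not_isLyapunovStable (h : IsDiagonalCoordinate F p z μ K) {i : ι}
    (hi : 1 < |μ i|) (hcone : ∃ᶠ y in 𝓝 p, y ≠ p ∧ ∀ j, |z y j| ≤ |z y i|) :
    ¬ IsLyapunovStable F p := by
  intro hst
  obtain ⟨U, hU, hleave⟩ := h.exists_nhds_leaving
  obtain ⟨V, hV, hstay⟩ := hst U hU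
  obtain ⟨y, ⟨hyp, hy⟩, hyU, hyV⟩ :=
    (hcone.and_eventually ((eventually_mem_set.2 hU).and (eventually_mem_set.2 hV))).exists
  obtain ⟨k, hk⟩ := hleave y hyU hyp ⟨i, hi, hy⟩
  exact hk (hstay y hyV k)

theorem IsDiagonalCoordinate.isAsymptoticallyStable (h : IsDiagonalCoordinate F p z μ K)
    (hμ : ∀ i, |μ i| < 1) : IsAsymptoticallyStable F p := by
  obtain ⟨ρ, hρ0, hρ1, hρ⟩ : ∃ ρ : ℝ, 0 ≤ ρ ∧ ρ < 1 ∧ ∀ i, |μ i| ≤ ρ := by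
    rcases isEmpty_or_nonempty ι with hι | hι
    · exact ⟨0, le_rfl, one_pos, fun i => hι.elim i⟩
    · obtain ⟨i, hi⟩ := Finite.exists_max fun i => |μ i|
      exact ⟨|μ i|, abs_nonneg _, hμ i, hi⟩
  set q := ρ + (1 - ρ) / 2 with hq
  have hq0 : 0 ≤ q := by linarith
  have hq1 : q < 1 := by linarith
  have hK := h.pos
  have hFtend : Tendsto F (𝓝 p) (𝓝 p) := by
    have := h.continuousAt.tendsto
    rwa [h.fixed] at this
  -- The distance bound is required at `F y`, not at `y`: in the induction below the next orbit
  -- point is not yet known to lie in the ball.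
  obtain ⟨δ, hδ, hball⟩ := Metric.eventually_nhds_iff.1
    (h.norm_le.and ((hFtend.eventually h.dist_le).and (h.linear ((1 - ρ) / 2) (by linarith))))
  have hstep : ∀ y, dist y p < δ → ‖z (F y)‖ ≤ q * ‖z y‖ := by
    intro y hy
    refine (pi_norm_le_iff_of_nonneg (by positivity)).2 fun i => ?_
    have h1 := (hball hy).2.2 i
    have h2 := abs_sub_abs_le_abs_sub (z (F y) i) (μ i * z y i)
    rw [abs_mul] at h2
    have h3 : |μ i| * |z y i| ≤ ρ * ‖z y‖ := by
      gcongr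
      · exact hρ i
      · exact norm_le_pi_norm (z y) i
    rw [Real.norm_eq_abs, hq]
    linarith
  -- The factor `K * K` pays for passing from distance to coordinates and back; in between the
  -- coordinate norm only decreases.
  have horbit : ∀ r > 0, r ≤ δ → ∀ c, dist c p < min r (r / (K * K)) → ∀ k : ℕ,
      dist (F^[k] c) p < r ∧ ‖z (F^[k] c)‖ ≤ q ^ k * ‖z c‖ := by
    intro r hr hrδ c hc k
    have hc1 := hc.trans_le (min_le_left _ _)
    have hc2 := hc.trans_le (min_le_right _ _)
    induction k with
    | zero => exact ⟨hc1, by simp⟩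
    | succ k ih =>
      rw [Function.iterate_succ_apply']
      have hy := ih.1.trans_le hrδ
      have h2 : ‖z (F (F^[k] c))‖ ≤ q ^ (k + 1) * ‖z c‖ := by
        calc _ ≤ q * ‖z (F^[k] c)‖ := hstep _ hy
          _ ≤ q * (q ^ k * ‖z c‖) := by gcongr; exact ih.2
          _ = _ := by ring
      refine ⟨?_, h2⟩
      have h3 : q ^ (k + 1) * ‖z c‖ ≤ 1 * ‖z c‖ := by
        gcongr
        exact pow_le_one₀ hq0 hq1.le
      calc dist (F (F^[k] c)) p ≤ K * ‖z (F (F^[k] c))‖ := (hball hy).2.1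
        _ ≤ K * (K * dist c p) := by
          gcongr
          linarith [(hball (hc1.trans_le hrδ)).1]
        _ < K * (K * (r / (K * K))) := by gcongr
        _ = r := by field_simp
  refine ⟨fun U hU => ?_, ?_⟩
  · obtain ⟨r, hr, hrU⟩ := Metric.mem_nhds_iff.1 hU
    refine ⟨Metric.ball p (min (min r δ) (min r δ / (K * K))),
      Metric.ball_mem_nhds p (by positivity), fun c hc k => hrU ?_⟩
    exact ((horbit _ (by positivity) (min_le_right _ _) c hc k).1).trans_le (min_le_left _ _)
  · refine mem_of_superset (Metric.ball_mem_nhds p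
      (show 0 < min δ (δ / (K * K)) by positivity)) fun c hc => ?_
    have horb := horbit δ hδ le_rfl c hc
    change Tendsto _ _ _
    rw [← tendsto_add_atTop_iff_nat 1, tendsto_iff_dist_tendsto_zero]
    have hlim : Tendsto (fun k : ℕ => K * (q ^ (k + 1) * ‖z c‖)) atTop (𝓝 0) := by
      have := (((tendsto_pow_atTop_nhds_zero_of_lt_one hq0 hq1).comp
        (tendsto_add_atTop_nat 1)).mul_const ‖z c‖).const_mul K
      simpa using this
    refine squeeze_zero (fun _ => dist_nonneg) (fun k => ?_) hlim
    rw [Function.iterate_succ_apply']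
    refine ((hball (horb k).1).2.1).trans ?_
    gcongr
    have := (horb (k + 1)).2
    rwa [Function.iterate_succ_apply'] at this

end Dynamics

/-! ### Spectrum of the linearized round trip and its coordinates -/

section Stability

variable {N : ℕ} {C Ω : Set (Euc N)} {F : frontier C → frontier C}

theorem IsConvexCore.finrank_tangentSpace (hC : IsConvexCore C) (c : frontier C) :
    Module.finrank ℝ (tangentSpace C c) = N - 1 := by
  have h1 := Submodule.finrank_add_finrank_orthogonal
    (Submodule.span ℝ {outwardNormal C (c : Euc N)})
  have hne : outwardNormal C (c : Euc N) ≠ 0 := fun h => by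
    have := hC.norm_outwardNormal c.2
    rw [h, norm_zero] at this
    exact zero_ne_one this
  rw [finrank_span_singleton hne, finrank_euclideanSpace, Fintype.card_fin] at h1
  change Module.finrank ℝ ↥(Submodule.span ℝ {outwardNormal C (c : Euc N)})ᗮ = N - 1
  omega

theorem IsReturnMap.roundTripOperator_isSymmetric (hC : IsConvexCore C) (hF : IsReturnMap C Ω F)
    (p : frontier C) : (roundTripOperator C Ω p).IsSymmetric := by
  intro x y
  have h := hC.radialOperator_symm Ω p (Ring.inverse (radialOperator C Ω p) x)
    (Ring.inverse (radialOperator C Ω p) y)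
  rw [hF.radialOperator_inverse hC, hF.radialOperator_inverse hC] at h
  change ⟪thickness C Ω p • Ring.inverse (radialOperator C Ω p) x, y⟫
    = ⟪x, thickness C Ω p • Ring.inverse (radialOperator C Ω p) y⟫
  rw [real_inner_smul_left, real_inner_smul_right, h]

theorem IsReturnMap.roundTripOperator_pos (hC : IsConvexCore C) (hF : IsReturnMap C Ω F)
    (p : frontier C) {v : tangentSpace C p} (hv : v ≠ 0) : 0 < ⟪roundTripOperator C Ω p v, v⟫ := by
  set x := Ring.inverse (radialOperator C Ω p) v with hx
  have hBx : radialOperator C Ω p x = v := hF.radialOperator_inverse hC p v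
  have hx0 : x ≠ 0 := fun h => hv (by rw [← hBx, h, map_zero])
  have h1 := hF.norm_sq_le_inner_radialOperator hC p x
  rw [hBx, real_inner_comm] at h1
  change 0 < ⟪thickness C Ω p • x, v⟫
  rw [real_inner_smul_left]
  have := norm_pos_iff.2 hx0
  exact mul_pos (hF.thickness_pos hC p) (lt_of_lt_of_le (by positivity) h1)

/-- The inner product on the tangent space defined by the radial operator. -/
@[reducible] noncomputable def IsReturnMap.radialCore (hC : IsConvexCore C) (hF : IsReturnMap C Ω F)
    (p : frontier C) : InnerProductSpace.Core ℝ (tangentSpace C p) where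
  inner x y := ⟪radialOperator C Ω p x, y⟫
  conj_inner_symm x y := by
    rw [hC.radialOperator_symm, real_inner_comm]
    rfl
  re_inner_nonneg x := (sq_nonneg ‖x‖).trans (hF.norm_sq_le_inner_radialOperator hC p x)
  add_left x y z := by rw [map_add, inner_add_left]
  smul_left x y r := by rw [map_smul, real_inner_smul_left]; rfl
  definite x hx := by
    have h1 := (hF.norm_sq_le_inner_radialOperator hC p x).trans_eq hx
    exact norm_eq_zero.1 (pow_eq_zero_iff two_ne_zero |>.1 (le_antisymm h1 (sq_nonneg _)))

/-- The linearized round trip has a basis of eigenvectors. -/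
theorem IsReturnMap.exists_eigenbasis (hC : IsConvexCore C)
    (hF : IsReturnMap C Ω F) (hd : SurfaceContDiff 2 (thickness C Ω)) (p : frontier C) :
    ∃ (e : Module.Basis (Fin (Module.finrank ℝ (tangentSpace C p))) ℝ (tangentSpace C p))
      (μ : Fin (Module.finrank ℝ (tangentSpace C p)) → ℝ),
      ∀ i, roundTripLinearization C Ω p (e i) = μ i • e i := by
  refine exists_eigenbasis_of_core (hF.radialCore hC p)
    (roundTripLinearization C Ω p : tangentSpace C p →ₗ[ℝ] tangentSpace C p) fun x y => ?_
  -- Multiplied by `B`, the linearization becomes `B + d Hess d`, a sum of symmetric operators.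
  have key : ∀ x, radialOperator C Ω p (roundTripLinearization C Ω p x)
      = radialOperator C Ω p x + thickness C Ω p • surfaceHess (thickness C Ω) p x := by
    intro x
    change radialOperator C Ω p (x + thickness C Ω p •
      Ring.inverse (radialOperator C Ω p) (surfaceHess (thickness C Ω) p x)) = _
    rw [map_add, map_smul, hF.radialOperator_inverse hC]
  change ⟪radialOperator C Ω p (roundTripLinearization C Ω p x), y⟫
    = ⟪radialOperator C Ω p x, roundTripLinearization C Ω p y⟫
  rw [hC.radialOperator_symm Ω p x, key, key, inner_add_left, inner_add_right,
    real_inner_smul_left, real_inner_smul_right, surfaceHess_symm hC hd,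
    hC.radialOperator_symm]

theorem IsReturnMap.stabilityType_eq (hC : IsConvexCore C) (hΩ : ClassO C Ω)
    (hF : IsReturnMap C Ω F) (hd : SurfaceContDiff 2 (thickness C Ω)) {p : frontier C}
    (hp : F p = p) :
    stabilityType F p = spectralType
      (roundTripLinearization C Ω p : tangentSpace C p →ₗ[ℝ] tangentSpace C p) := by
  unfold stabilityType
  rw [(hF.hasSurfaceDerivAt hC hΩ hd hp).surfaceDeriv_eq hC]
  congr 1
  ext1 v
  exact tangentProj_coe p _

/-- Coordinates in an eigenbasis of the differential of a map at a fixed point. -/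
noncomputable def eigenCoordinate {p : frontier C} {ι : Type*} [Fintype ι]
    (e : Module.Basis ι ℝ (tangentSpace C p)) (y : frontier C) : ι → ℝ :=
  e.equivFun (tangentProj C p ((y : Euc N) - p))

/-- Near `p` a chord is comparable to its tangential projection, so eigencoordinates of the
projection control the distance to `p`, and differentiability at `p` becomes the diagonal estimate.
-/
theorem exists_isDiagonalCoordinate (hC : IsConvexCore C) {p : frontier C} (hp : F p = p)
    {L : tangentSpace C p →L[ℝ] tangentSpace C p}
    (hL : HasSurfaceDerivAt (fun y : frontier C => (F y : Euc N)) p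
      ((tangentSpace C p).subtypeL ∘L L)) {ι : Type*} [Fintype ι]
    {e : Module.Basis ι ℝ (tangentSpace C p)} {μ : ι → ℝ} (he : ∀ i, L (e i) = μ i • e i) :
    ∃ K, IsDiagonalCoordinate F p (eigenCoordinate e) μ K := by
  let E : tangentSpace C p ≃L[ℝ] (ι → ℝ) := e.equivFun.toContinuousLinearEquiv
  have hE : ∀ y : frontier C, eigenCoordinate e y = E (tangentProj C p ((y : Euc N) - p)) :=
    fun _ => rfl
  set u : frontier C → Euc N := fun y => (y : Euc N) - p with hu
  have hdist : ∀ y : frontier C, dist y p = ‖u y‖ := fun y => by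
    rw [Subtype.dist_eq, dist_eq_norm]
  have hzu : eigenCoordinate e =O[𝓝 p] u :=
    ((E : tangentSpace C p →L[ℝ] ι → ℝ) ∘L tangentProj C p).isBigO_comp u (𝓝 p)
  have hPu : (fun y => tangentProj C p (u y)) =O[𝓝 p] eigenCoordinate e :=
    ((E.symm : (ι → ℝ) →L[ℝ] tangentSpace C p).isBigO_comp (eigenCoordinate e) (𝓝 p)).congr_left
      fun y => by rw [hE]; exact E.symm_apply_apply _
  have huz : u =O[𝓝 p] eigenCoordinate e := by
    have h1 : (fun y => (tangentProj C p (u y) : Euc N)) =O[𝓝 p] eigenCoordinate e :=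
      ((tangentSpace C p).subtypeL.isBigO_comp _ _).trans hPu
    have h2 : u =O[𝓝 p] fun y => (tangentProj C p (u y) : Euc N) := by
      have h3 := (hC.isLittleO_sub_tangentProj p).right_isBigO_sub
      exact h3.congr_right fun y => sub_sub_cancel _ _
    exact h2.trans h1
  obtain ⟨K₁, hK₁, h₁⟩ := huz.exists_pos
  obtain ⟨K₂, hK₂, h₂⟩ := hzu.exists_pos
  refine ⟨max K₁ K₂, lt_max_of_lt_left hK₁, hp, ?_, ?_, ?_, ?_⟩
  · exact Topology.IsInducing.subtypeVal.continuousAt_iff.2 hL.continuousAt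
  · filter_upwards [h₁.bound] with y hy
    rw [hdist]
    exact hy.trans (by gcongr; exact le_max_left _ _)
  · filter_upwards [h₂.bound] with y hy
    rw [hdist]
    exact hy.trans (by gcongr; exact le_max_right _ _)
  · intro ε hε
    have h3 := ((((E : tangentSpace C p →L[ℝ] ι → ℝ) ∘L tangentProj C p).isBigO_comp _
      _).trans_isLittleO hL).trans_isBigO huz
    filter_upwards [h3.def hε] with y hy i
    have h4 : ((E : tangentSpace C p →L[ℝ] ι → ℝ) ∘L tangentProj C p)
        ((F y : Euc N) - F p - ((tangentSpace C p).subtypeL ∘L L) (tangentProj C p (u y)))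
        = eigenCoordinate e (F y) - E (L (tangentProj C p (u y))) := by
      rw [map_sub, hp]
      congr 1
      simp only [ContinuousLinearMap.comp_apply, Submodule.subtypeL_apply, tangentProj_coe]
      rfl
    have h5 : E (L (tangentProj C p (u y))) i = μ i * eigenCoordinate e y i :=
      repr_apply_of_eigenbasis (L := (L : tangentSpace C p →ₗ[ℝ] tangentSpace C p)) he
        (tangentProj C p (u y)) i
    have h6 := (norm_le_pi_norm (eigenCoordinate e (F y) - E (L (tangentProj C p (u y)))) i).trans
      (h4 ▸ hy)
    rwa [Pi.sub_apply, h5, Real.norm_eq_abs] at h6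

/-- Supplies starting points in the expanding cone arbitrarily near `p`: along a boundary curve with
velocity `e i`, the rescaled coordinates tend to the `i`-th unit vector. -/
theorem frequently_eigenCoordinate (hC : IsConvexCore C) {p : frontier C} {ι : Type*} [Fintype ι]
    (e : Module.Basis ι ℝ (tangentSpace C p)) (i : ι) :
    ∃ᶠ y in 𝓝 p, y ≠ p ∧ ∀ j, |eigenCoordinate e y j| ≤ |eigenCoordinate e y i| := by
  classical
  obtain ⟨γ, h0, hγ⟩ := hC.exists_curve p (e i)
  let E : tangentSpace C p →L[ℝ] (ι → ℝ) := e.equivFun.toContinuousLinearEquiv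
  have h1 : HasDerivWithinAt (fun t => eigenCoordinate e (γ t)) (Pi.single i 1) (Ioi 0) 0 := by
    have h2 := (E ∘L tangentProj C p).hasFDerivAt.comp_hasDerivWithinAt (0 : ℝ)
      (hγ.sub_const (p : Euc N))
    have h3 : (E ∘L tangentProj C p) (e i : Euc N) = Pi.single i 1 := by
      rw [ContinuousLinearMap.comp_apply, tangentProj_coe]
      ext j
      change e.repr (e i) j = _
      rw [Module.Basis.repr_self, Finsupp.single_apply, Pi.single_apply]
      simp [eq_comm]
    rw [h3] at h2
    exact h2
  have hz0 : eigenCoordinate e p = 0 := by simp [eigenCoordinate]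
  have h2 := hasDerivWithinAt_iff_tendsto_slope.1 h1
  rw [sdiff_singleton_eq_self self_notMem_Ioi] at h2
  have h3 := (Metric.tendsto_nhds.1 h2 (1 / 2) (by norm_num))
  refine (tendsto_of_curve h0 hγ).frequently (Eventually.frequently ?_)
  filter_upwards [h3, self_mem_nhdsWithin] with t ht ht0
  have ht0 : 0 < t := ht0
  rw [slope_def_module, h0, hz0, sub_zero, sub_zero, dist_eq_norm] at ht
  have h4 : ∀ j, |t⁻¹ * eigenCoordinate e (γ t) j - (Pi.single i 1 : ι → ℝ) j| < 1 / 2 := fun j =>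
    (norm_le_pi_norm (t⁻¹ • eigenCoordinate e (γ t) - (Pi.single i 1 : ι → ℝ)) j).trans_lt ht
  have h5 : 1 / 2 < |t⁻¹ * eigenCoordinate e (γ t) i| := by
    have h6 := h4 i
    rw [Pi.single_eq_same] at h6
    have := (abs_lt.1 h6).1
    exact lt_of_lt_of_le (by linarith) (le_abs_self _)
  refine ⟨fun h => ?_, fun j => ?_⟩
  · rw [h, hz0, Pi.zero_apply, mul_zero, abs_zero] at h5
    norm_num at h5
  · rcases eq_or_ne j i with rfl | hji
    · rfl
    · have h6 := h4 j
      rw [Pi.single_eq_of_ne hji, sub_zero] at h6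
      have h7 := h6.trans h5
      rw [abs_mul, abs_mul] at h7
      exact (lt_of_mul_lt_mul_left h7 (abs_nonneg _)).le

end Stability

/-! ### Limits of orbits and basins -/

section Basins

variable {N : ℕ} {C Ω : Set (Euc N)} {F : frontier C → frontier C}

/-- If `y → p` and `F y → p` along a filter, then `p` is critical for the thickness function. -/
theorem IsReturnMap.mem_Crit_of_tendsto (hC : IsConvexCore C) (hΩ : ClassO C Ω)
    (hF : IsReturnMap C Ω F) (hd : SurfaceContDiff 1 (thickness C Ω)) {p : frontier C}
    {l : Filter (frontier C)} [l.NeBot] (hl : l ≤ 𝓝 p) (hFl : Tendsto F l (𝓝 p)) :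
    p ∈ Crit (thickness C Ω) := by
  obtain ⟨G, hG⟩ := hC.exists_normalExtension p.2
  obtain ⟨g, hg, hfg⟩ := hd p
  have hg : ContDiffAt ℝ 1 g p := by simpa using hg
  set f := thickness C Ω with hf
  have hval : Tendsto ((↑) : frontier C → Euc N) (𝓝 p) (𝓝 (p : Euc N)) :=
    continuous_subtype_val.tendsto p
  have hfd : HasSurfaceDerivAt f p _ :=
    hC.hasSurfaceDerivAt (hg.differentiableAt (by norm_num)).hasFDerivAt hfg
  rw [mem_Crit_iff hC]
  convert hfd using 1
  refine (ContinuousLinearMap.ext fun v => ?_).symm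
  set ν : frontier C → Euc N := fun y => outwardNormal C (y : Euc N) with hν_def
  have hν : ‖ν p‖ = 1 := hC.norm_outwardNormal p.2
  have hνc : Tendsto ν l (𝓝 (ν p)) := (hC.continuous_outwardNormal.tendsto p).mono_left hl
  have hfc : Tendsto f l (𝓝 (f p)) := hfd.continuousAt.tendsto.mono_left hl
  have hvl : Tendsto ((↑) : frontier C → Euc N) l (𝓝 (p : Euc N)) := hval.mono_left hl
  -- The key identity at `y` needs a vector tangent at `y`; projecting the fixed `v` provides one
  -- that converges to `v`.
  let v' : ∀ y : frontier C, tangentSpace C y := fun y => tangentProj C y (v : Euc N)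
  have hv' : Tendsto (fun y => (v' y : Euc N)) l (𝓝 (v : Euc N)) := by
    have h1 : Tendsto (fun y => (v : Euc N) - ⟪ν y, (v : Euc N)⟫ • ν y) l
        (𝓝 ((v : Euc N) - ⟪ν p, (v : Euc N)⟫ • ν p)) :=
      tendsto_const_nhds.sub ((hνc.inner tendsto_const_nhds).smul hνc)
    rw [inner_outwardNormal_coe, zero_smul, sub_zero] at h1
    exact h1.congr fun y => (hC.coe_tangentProj y _).symm
  have hGc : Tendsto (fun y : frontier C => fderiv ℝ G y) l (𝓝 (fderiv ℝ G p)) :=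
    ((hG.contDiffAt.fderiv_right (m := 0) (by norm_num)).continuousAt.tendsto).comp hvl
  have hgc : Tendsto (fun y : frontier C => fderiv ℝ g y) l (𝓝 (fderiv ℝ g p)) :=
    ((hg.fderiv_right (m := 0) (by norm_num)).continuousAt.tendsto).comp hvl
  -- This vector is a multiple of the unit normal at `Φ(y)`. Using it in place of `n` gives a
  -- convergent sequence without any continuity of the normal.
  have hm : Tendsto (fun y => (F y : Euc N) - radialMap C Ω y) l (𝓝 (-(f p • ν p))) := by
    have := (hval.comp hFl).sub (hvl.add (hfc.smul hνc))
    rw [show (p : Euc N) - (p + f p • ν p) = -(f p • ν p) by abel] at this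
    exact this
  have happ : ContinuousAt (fun q : (Euc N →L[ℝ] Euc N) × Euc N => q.1 q.2)
      (fderiv ℝ G p, (v : Euc N)) := isBoundedBilinearMap_apply.continuous.continuousAt
  have happ' : ContinuousAt (fun q : (Euc N →L[ℝ] ℝ) × Euc N => q.1 q.2)
      (fderiv ℝ g p, (v : Euc N)) := isBoundedBilinearMap_apply.continuous.continuousAt
  have hlim : Tendsto (fun y => ⟪(F y : Euc N) - radialMap C Ω y,
        (v' y : Euc N) + f y • fderiv ℝ G y (v' y)⟫
      + fderiv ℝ g y (v' y) * ⟪(F y : Euc N) - radialMap C Ω y, ν y⟫) l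
      (𝓝 (⟪-(f p • ν p), (v : Euc N) + f p • fderiv ℝ G p (v : Euc N)⟫
        + fderiv ℝ g p (v : Euc N) * ⟪-(f p • ν p), ν p⟫)) :=
    (hm.inner (hv'.add (hfc.smul (happ.tendsto.comp (hGc.prodMk_nhds hv'))))).add
      ((happ'.tendsto.comp (hgc.prodMk_nhds hv')).mul (hm.inner hνc))
  have hzero : ∀ᶠ y in l, ⟪(F y : Euc N) - radialMap C Ω y,
        (v' y : Euc N) + f y • fderiv ℝ G y (v' y)⟫
      + fderiv ℝ g y (v' y) * ⟪(F y : Euc N) - radialMap C Ω y, ν y⟫ = 0 := by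
    filter_upwards [hvl.eventually hG.eventually, hl (eventually_eventually_nhds.2 hfg),
      hvl.eventually (eventually_differentiableAt_of_contDiffAt hg)] with y h1 h2 h3
    obtain ⟨-, n, t, hn, -, hFy⟩ := hF y
    have h4 := hF.inner_inwardNormal_eq_zero hC hΩ hn (hC.hasSurfaceDerivAt h3.hasFDerivAt h2) (v' y)
    have h5 : (radialOperator C Ω y (v' y) : Euc N)
        = (v' y : Euc N) + f y • fderiv ℝ G y (v' y) := by
      simp [radialOperator, hC.coe_shapeOperator h1, hf]
    rw [h5, ContinuousLinearMap.comp_apply, Submodule.subtypeL_apply] at h4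
    rw [hFy, add_sub_cancel_left, real_inner_smul_left, real_inner_smul_left]
    linear_combination t * h4
  have h0 := tendsto_nhds_unique (hlim.congr' hzero) tendsto_const_nhds
  have hGν : ⟪ν p, fderiv ℝ G p (v : Euc N)⟫ = 0 := by
    rw [hν_def]
    simp only
    rw [hG.eq_self]
    exact inner_fderiv_self_of_norm_eq_one (hG.contDiffAt.differentiableAt (by norm_num))
      hG.norm_eq_one _
  -- Both tangential terms vanish against `ν p`; the limit identity reduces to `d(p) * Dd(p) v = 0`.
  rw [inner_neg_left, inner_neg_left, real_inner_smul_left, real_inner_smul_left, inner_add_right,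
    real_inner_smul_right, hGν, inner_outwardNormal_coe, real_inner_self_eq_norm_sq, hν] at h0
  have hpos := hF.thickness_pos hC p
  have h1 : fderiv ℝ g p (v : Euc N) * f p = 0 := by linarith
  exact (mul_eq_zero.1 h1).resolve_right hpos.ne'

theorem IsReturnMap.mem_Crit_of_mem_basin (hC : IsConvexCore C) (hΩ : ClassO C Ω)
    (hF : IsReturnMap C Ω F) (hd : SurfaceContDiff 1 (thickness C Ω)) {p c : frontier C}
    (hc : c ∈ basin F p) : p ∈ Crit (thickness C Ω) := by
  have hc : Tendsto (fun k : ℕ => F^[k] c) atTop (𝓝 p) := hc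
  refine hF.mem_Crit_of_tendsto hC hΩ hd (l := map (fun k : ℕ => F^[k] c) atTop) hc ?_
  rw [tendsto_map'_iff]
  refine ((tendsto_add_atTop_iff_nat 1).2 hc).congr fun k => ?_
  exact Function.iterate_succ_apply' F k c

theorem mem_basin_self {X : Type*} [TopologicalSpace X] {F : X → X} {p : X} (hp : F p = p) :
    p ∈ basin F p := by
  change Tendsto _ _ _
  simp only [Function.iterate_fixed hp]
  exact tendsto_const_nhds

theorem preimage_basin {X : Type*} [TopologicalSpace X] (F : X → X) (p : X) :
    F ⁻¹' basin F p = basin F p := by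
  ext c
  change Tendsto (fun k : ℕ => F^[k] (F c)) atTop (𝓝 p) ↔ Tendsto (fun k : ℕ => F^[k] c) atTop (𝓝 p)
  exact tendsto_add_atTop_iff_nat (f := fun k : ℕ => F^[k] c) 1

end Basins

end ReturnMap

/-! ### The theorem -/

open ReturnMap in
theorem theorem6p1 {N : ℕ} (C : Set (Euc N)) (hC : IsConvexCore C)
    (Ω : Set (Euc N)) (hΩ : ClassO C Ω)
    (F : frontier C → frontier C) (hF : IsReturnMap C Ω F) :
    -- the fixed points of `F` are the critical points of the thickness function
    Function.fixedPoints F = Crit (thickness C Ω) ∧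
    -- stability type of each fixed point
    (SurfaceContDiff 2 (thickness C Ω) → ∀ p ∈ Function.fixedPoints F,
      IsUnit (radialOperator C Ω p) ∧
      (roundTripOperator C Ω p).IsSymmetric ∧
      (∀ v : tangentSpace C p, v ≠ 0 → 0 < ⟪roundTripOperator C Ω p v, v⟫) ∧
      HasSurfaceDerivAt (fun y : frontier C => (F y : Euc N)) p
        ((tangentSpace C p).subtypeL ∘L roundTripLinearization C Ω p) ∧
      (⨆ μ : ℝ, Module.End.eigenspace
        (roundTripLinearization C Ω p : tangentSpace C p →ₗ[ℝ] tangentSpace C p) μ) = ⊤ ∧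
      stabilityType F p = spectralType
        (roundTripLinearization C Ω p : tangentSpace C p →ₗ[ℝ] tangentSpace C p) ∧
      ((stabilityType F p).1 = N - 1 → IsAsymptoticallyStable F p) ∧
      (0 < (stabilityType F p).2.2 → ¬ IsLyapunovStable F p) ∧
      ((stabilityType F p).2.2 = N - 1 → IsRepelling F p)) ∧
    -- basin decomposition
    (SurfaceContDiff 1 (thickness C Ω) →
      {p | (basin F p).Nonempty} = Crit (thickness C Ω) ∧
      (∀ p ∈ Crit (thickness C Ω), p ∈ basin F p ∧ F ⁻¹' basin F p = basin F p) ∧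
      (Crit (thickness C Ω)).PairwiseDisjoint (basin F) ∧
      (⋃ p ∈ Crit (thickness C Ω), basin F p) =
        {c | ∃ q, Tendsto (fun k : ℕ => F^[k] c) atTop (𝓝 q)}) := by
  have hfix := hF.fixedPoints_eq hC hΩ
  refine ⟨hfix, fun hd p hp => ?_, fun hd => ?_⟩
  · have hp : F p = p := hp
    have hderiv := hF.hasSurfaceDerivAt hC hΩ hd hp
    have hst := hF.stabilityType_eq hC hΩ hd hp
    obtain ⟨e, μ, he⟩ := hF.exists_eigenbasis hC hd p
    obtain ⟨K, hK⟩ := exists_isDiagonalCoordinate hC hp hderiv he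
    refine ⟨hF.isUnit_radialOperator hC p, hF.roundTripOperator_isSymmetric hC p,
      fun v hv => hF.roundTripOperator_pos hC p hv, hderiv, iSup_eigenspace_eq_top he, hst, ?_, ?_,
      ?_⟩
    · intro h
      rw [hst, ← hC.finrank_tangentSpace p] at h
      exact hK.isAsymptoticallyStable (mem_of_finrank_iSup_eigenspace_eq he h)
    · intro h
      rw [hst] at h
      obtain ⟨i, hi⟩ := exists_mem_of_finrank_iSup_eigenspace_pos he h
      exact hK.not_isLyapunovStable hi (frequently_eigenCoordinate hC e i)
    · intro h
      rw [hst, ← hC.finrank_tangentSpace p] at h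
      exact hK.isRepelling (mem_of_finrank_iSup_eigenspace_eq he h)
  · have hself : ∀ p ∈ Crit (thickness C Ω), p ∈ basin F p := fun p hp =>
      mem_basin_self (by rw [← hfix] at hp; exact hp)
    refine ⟨?_, fun p hp => ⟨hself p hp, preimage_basin F p⟩, ?_, ?_⟩
    · ext p
      exact ⟨fun ⟨c, hc⟩ => hF.mem_Crit_of_mem_basin hC hΩ hd hc, fun hp => ⟨p, hself p hp⟩⟩
    · intro p _ q _ hpq
      exact Set.disjoint_left.2 fun c hcp hcq => hpq (tendsto_nhds_unique hcp hcq)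
    · ext c
      simp only [mem_iUnion, exists_prop]
      exact ⟨fun ⟨q, _, hq⟩ => ⟨q, hq⟩,
        fun ⟨q, hq⟩ => ⟨q, hF.mem_Crit_of_mem_basin hC hΩ hd hq, hq⟩⟩
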